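/- For finite simple graphs $H,G$ let $t(H,G)=|\mathrm{hom}(H,G)|/|V(G)|^{|V(H)|}$ be the homomorphism density. A graphon is a symmetric measurable function $f:[0,1]^2\to[0,1]$, and for a graph $H$ on $\{1,\dots,m\}$ let $t(H,f)=\int_{[0,1]^m}\prod_{\{i,j\}\in E(H)}f(x_i,x_j)\,dx_1\cdots dx_m$. For $G$ a graph or a graphon, put $t(G)=(t(K_2,G),t(K_3,G))\in\mathbb R^2$. For $n\ge 1$ let $S_n$ be the set of all $t(G)$ with $G$ a simple graph on $n$ labelled nodes, and $P_n=\mathrm{conv}(S_n)$; let $R=\{t(f): f \text{ a graphon}\}$ and $P=\mathrm{conv}(R)$. For $k\ge 0$ let $v_{k,n}=t(T(n,k+1))$, where $T(n,r)$ is the Turán graph on $n$ nodes with $r$ classes, let $L_{k,n}$ be the closed segment joining $v_{k,n}$ and $v_{k+1,n}$, and let $v_k=t(f^{K_{k+1}})$, where $f^{K_r}$ is the Turán graphon with $r$ classes: $f^{K_1}=0$, and for $r\ge2$, $f^{K_r}(x,y)=1$ if $\lfloor rx\rfloor\ne\lfloor ry\rfloor$ and $0$ otherwise. 1. For every $n\ge1$,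 $P_n$ is the convex hull of the points $v_{k,n}$, $k=0,1,\dots,\lceil n/2\rceil-1$, together with $v_{n-1,n}$. 2. $P$ is compact, and $\lim_{n\to\infty}P_n=P$ in the Hausdorff distance. 3. Let $k\ge0$ and let $n\ge1$ be a multiple of $(k+1)(k+2)$. Then $v_{k,n}=v_k$ and $v_{k+1,n}=v_{k+1}$. If moreover $k\ge1$, then $L_{k,n}\cap S_n=\{v_k,v_{k+1}\}$. -/

import Mathlib

open MeasureTheory Filter Topology
open scoped unitInterval

noncomputable section

namespace EdgeTriangle

/-- The homomorphism density `t(H, G) = |hom(H, G)| / |V(G)| ^ |V(H)|`. -/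
def homDensity {m n : ℕ} (H : SimpleGraph (Fin m)) (G : SimpleGraph (Fin n)) : ℝ :=
  (Nat.card (H →g G) : ℝ) / (n : ℝ) ^ m

/-- Graphons: symmetric measurable functions from `[0,1]²` into `[0,1]`. -/
structure Graphon where
  toFun : I → I → ℝ
  measurable_toFun : Measurable fun p : I × I => toFun p.1 p.2
  symm : ∀ x y, toFun x y = toFun y x
  mem_Icc : ∀ x y, toFun x y ∈ Set.Icc (0 : ℝ) 1

/-- The factor `f(x_i, x_j)` attached to the unordered pair `{i, j}`. -/
def Graphon.pairValue (f : Graphon) {m : ℕ} (x : Fin m → I) : Sym2 (Fin m) → ℝ :=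
  Sym2.lift ⟨fun i j => f.toFun (x i) (x j), fun i j => f.symm (x i) (x j)⟩

/-- The homomorphism density of `H` in a graphon:
`t(H, f) = ∫_{[0,1]^m} ∏_{{i,j} ∈ E(H)} f(x_i, x_j) dx`. -/
def Graphon.homDensity (f : Graphon) {m : ℕ} (H : SimpleGraph (Fin m))
    [DecidableRel H.Adj] : ℝ :=
  ∫ x : Fin m → I, ∏ e ∈ H.edgeFinset, f.pairValue x e

/-- The edge-triangle density vector of a graph on `n` labelled nodes. -/
def tGraph {n : ℕ} (G : SimpleGraph (Fin n)) : EuclideanSpace ℝ (Fin 2) :=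
  !₂[EdgeTriangle.homDensity (⊤ : SimpleGraph (Fin 2)) G,
     EdgeTriangle.homDensity (⊤ : SimpleGraph (Fin 3)) G]

/-- The edge-triangle density vector of a graphon. -/
def tGraphon (f : Graphon) : EuclideanSpace ℝ (Fin 2) :=
  !₂[f.homDensity (⊤ : SimpleGraph (Fin 2)), f.homDensity (⊤ : SimpleGraph (Fin 3))]

/-- The density vectors of all simple graphs on `n` nodes. -/
def S (n : ℕ) : Set (EuclideanSpace ℝ (Fin 2)) :=
  Set.range fun G : SimpleGraph (Fin n) => tGraph G

/-- The convex hull of the density vectors of all simple graphs on `n` nodes. -/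
def Pn (n : ℕ) : Set (EuclideanSpace ℝ (Fin 2)) :=
  convexHull ℝ (S n)

/-- All realizable edge-triangle density vectors of graphons. -/
def R : Set (EuclideanSpace ℝ (Fin 2)) :=
  Set.range tGraphon

/-- The convex hull of all realizable edge-triangle density vectors. -/
def P : Set (EuclideanSpace ℝ (Fin 2)) :=
  convexHull ℝ R

/-- The identically zero graphon. -/
def zeroGraphon : Graphon where
  toFun _ _ := 0
  measurable_toFun := measurable_const
  symm _ _ := rfl
  mem_Icc _ _ := ⟨le_rfl, zero_le_one⟩

/-- The Turán graphon with `k` classes: the zero graphon for `k = 1`, and otherwise the indicator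
of `⌊x k⌋ ≠ ⌊y k⌋`. -/
def turanGraphon (k : ℕ) : Graphon :=
  if k = 1 then zeroGraphon else
  { toFun := fun x y => if ⌊(x : ℝ) * k⌋ = ⌊(y : ℝ) * k⌋ then 0 else 1
    measurable_toFun := by
      refine Measurable.ite (measurableSet_eq_fun ?_ ?_) measurable_const measurable_const
      · exact Int.measurable_floor.comp ((measurable_subtype_coe.comp measurable_fst).mul_const _)
      · exact Int.measurable_floor.comp ((measurable_subtype_coe.comp measurable_snd).mul_const _)
    symm := fun x y => by simp only [eq_comm]
    mem_Icc := fun x y => by split_ifs <;> simp }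

/-- The density vector of the Turán graphon with `k + 1` classes. -/
def v (k : ℕ) : EuclideanSpace ℝ (Fin 2) :=
  tGraphon (turanGraphon (k + 1))

/-- The density vector of the Turán graph on `n` nodes with `k + 1` classes. -/
def vn (k n : ℕ) : EuclideanSpace ℝ (Fin 2) :=
  tGraph (SimpleGraph.turanGraph n (k + 1))

/-- The segment joining the density vectors of the Turán graphs on `n` nodes with `k + 1` and
`k + 2` classes. -/
def Ln (k n : ℕ) : Set (EuclideanSpace ℝ (Fin 2)) :=
  segment ℝ (vn k n) (vn (k + 1) n)

end EdgeTriangle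

end

/-!
A linear functional of `t(G)` is an energy `a * edgeCount + b * triCount`, defined more generally
for natural vertex weights. Moving weight between two vertices changes the energy affinely when they
are not adjacent, and through the product of their weights when all vertices of positive weight form
a clique. Among the weights of minimal energy, one of minimal support is therefore carried by a
clique and is equitable, so Turán graphs minimize every linear functional. For
`⌈n / 2⌉ - 1 ≤ k < n` the classes of `T(n, k + 1)` have one or two elements, which puts these
points `v_{k,n}` on one segment.

A random graph on `n` vertices sampled from a graphon has an expected density vector in `P_n` within
distance `4 / n` of that of the graphon, and step graphons give `P_n ⊆ P`; this yields the
convergence. Since `v_{k,n}` is within `4 / n` of `v_k`, it also shows that `P` is the convex hull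
of the compact set formed by the `v_k` and their limit `t(1)`.

On the chord of part 3 the functional vanishing there is nonnegative on `S_n`. If it vanishes at a
graph, then moving all weights onto a clique through a given edge `uw` without decreasing the
codegree of `u` and `w` shows that the Hessian entry at `uw` is negative, whereas it would vanish if
some `v` were adjacent to neither `u` nor `w`. So the graph is complete multipartite, and its class
sizes are zeros of a cubic with roots at the class sizes of the two endpoints.
-/

noncomputable section

namespace EdgeTriangle

/-! ### Weighted edge and triangle counts -/

section Weighted

variable {V : Type*} {G : SimpleGraph V} {p q x y : V}

/-- The real-valued adjacency indicator of a graph. -/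
def adj (G : SimpleGraph V) (x y : V) : ℝ := G.edgeSet.indicator 1 s(x, y)

lemma adj_comm (G : SimpleGraph V) (x y : V) : adj G x y = adj G y x := by
  rw [adj, adj, Sym2.eq_swap]

lemma adj_of_adj (h : G.Adj x y) : adj G x y = 1 :=
  Set.indicator_of_mem (G.mem_edgeSet.2 h) _

lemma adj_of_not_adj (h : ¬ G.Adj x y) : adj G x y = 0 :=
  Set.indicator_of_notMem (mt G.mem_edgeSet.1 h) _

lemma adj_self (G : SimpleGraph V) (x : V) : adj G x x = 0 :=
  adj_of_not_adj G.irrefl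

lemma adj_nonneg (G : SimpleGraph V) (x y : V) : 0 ≤ adj G x y :=
  Set.indicator_nonneg (fun _ _ => zero_le_one) _

lemma adj_comap {W : Type*} (c : V → W) (H : SimpleGraph W) (x y : V) :
    adj (H.comap c) x y = adj H (c x) (c y) := by
  by_cases hadj : H.Adj (c x) (c y)
  · rw [adj_of_adj hadj, adj_of_adj (SimpleGraph.comap_adj.2 hadj)]
  · rw [adj_of_not_adj hadj, adj_of_not_adj (mt SimpleGraph.comap_adj.1 hadj)]

lemma mul_adj_of_isClique [DecidableEq V] {f : V → ℝ} (hf : G.IsClique f.support)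
    (hx : f x ≠ 0) (y : V) :
    f y * adj G x y = f y - if x = y then f y else 0 := by
  by_cases hxy : x = y
  · simp [hxy, adj_self]
  by_cases hy : f y = 0
  · simp [hy]
  · simp [adj_of_adj (hf hx hy hxy), hxy]

variable [Fintype V] {a b s t : ℝ} {f : V → ℝ}

/-- The total weight of the neighbours of `x`. -/
def deg (G : SimpleGraph V) (f : V → ℝ) (x : V) : ℝ :=
  ∑ y, f y * adj G x y

/-- The total weight of the common neighbours of `x` and `y`. -/
def codeg (G : SimpleGraph V) (f : V → ℝ) (x y : V) : ℝ :=
  ∑ z, f z * (adj G x z * adj G y z)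

/-- The weighted number of ordered edges inside the neighbourhood of `x`. -/
def linkCount (G : SimpleGraph V) (f : V → ℝ) (x : V) : ℝ :=
  ∑ y, f y * (adj G x y * codeg G f x y)

/-- The weighted number of homomorphisms from `K₂` to `G`. -/
def edgeCount (G : SimpleGraph V) (f : V → ℝ) : ℝ :=
  ∑ x, f x * deg G f x

/-- The weighted number of homomorphisms from `K₃` to `G`. -/
def triCount (G : SimpleGraph V) (f : V → ℝ) : ℝ :=
  ∑ x, f x * linkCount G f x

/-- The linear combination of the edge and triangle counts that the extremal problem minimizes. -/
def energy (a b : ℝ) (G : SimpleGraph V) (f : V → ℝ) : ℝ :=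
  a * edgeCount G f + b * triCount G f

/-- The partial derivative of `energy a b G` in the weight of `p`. -/
def grad (a b : ℝ) (G : SimpleGraph V) (f : V → ℝ) (p : V) : ℝ :=
  2 * a * deg G f p + 3 * b * linkCount G f p

/-- The mixed second partial derivative of `energy a b G` in the weights of `p` and `q`. -/
def hess (a b : ℝ) (G : SimpleGraph V) (f : V → ℝ) (p q : V) : ℝ :=
  adj G p q * (2 * a + 6 * b * codeg G f p q)

lemma codeg_comm (G : SimpleGraph V) (f : V → ℝ) (x y : V) : codeg G f x y = codeg G f y x := by
  simp only [codeg, mul_comm (adj G x _)]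

lemma hess_comm (a b : ℝ) (G : SimpleGraph V) (f : V → ℝ) (p q : V) :
    hess a b G f p q = hess a b G f q p := by
  rw [hess, hess, adj_comm, codeg_comm]

lemma hess_of_adj (h : G.Adj p q) : hess a b G f p q = 2 * a + 6 * b * codeg G f p q := by
  rw [hess, adj_of_adj h, one_mul]

lemma hess_of_not_adj (h : ¬ G.Adj p q) : hess a b G f p q = 0 := by
  rw [hess, adj_of_not_adj h, zero_mul]

section AddSingle

variable [DecidableEq V]

lemma sum_add_single_mul (f g : V → ℝ) (p : V) (t : ℝ) :
    ∑ x, (f + Pi.single p t : V → ℝ) x * g x = ∑ x, f x * g x + t * g p := by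
  simp only [Pi.add_apply, Pi.single_apply, add_mul, ite_mul, zero_mul, Finset.sum_add_distrib,
    Finset.sum_ite_eq', Finset.mem_univ, if_true]

lemma deg_add_single (G : SimpleGraph V) (f : V → ℝ) (p x : V) (t : ℝ) :
    deg G (f + Pi.single p t) x = deg G f x + t * adj G x p :=
  sum_add_single_mul ..

lemma codeg_add_single (G : SimpleGraph V) (f : V → ℝ) (p x y : V) (t : ℝ) :
    codeg G (f + Pi.single p t) x y = codeg G f x y + t * (adj G x p * adj G y p) :=
  sum_add_single_mul ..

lemma linkCount_add_single (G : SimpleGraph V) (f : V → ℝ) (p x : V) (t : ℝ) :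
    linkCount G (f + Pi.single p t) x = linkCount G f x + 2 * t * (adj G x p * codeg G f x p) := by
  have hsum : ∑ y, f y * (adj G x y * codeg G (f + Pi.single p t) x y) =
      linkCount G f x + t * (adj G x p * codeg G f x p) := by
    rw [linkCount, codeg, Finset.mul_sum, Finset.mul_sum, ← Finset.sum_add_distrib]
    refine Finset.sum_congr rfl fun y _ => ?_
    rw [codeg_add_single, adj_comm G p y]
    ring
  rw [linkCount, sum_add_single_mul, hsum, codeg_add_single, adj_self]
  ring

lemma edgeCount_add_single (G : SimpleGraph V) (f : V → ℝ) (p : V) (t : ℝ) :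
    edgeCount G (f + Pi.single p t) = edgeCount G f + 2 * t * deg G f p := by
  have hsum : ∑ x, f x * adj G x p = deg G f p := by
    simp only [deg, adj_comm G p]
  rw [edgeCount, sum_add_single_mul, deg_add_single, adj_self]
  simp only [deg_add_single, mul_add, mul_left_comm _ t, Finset.sum_add_distrib,
    ← Finset.mul_sum, hsum]
  rw [edgeCount]
  ring

lemma triCount_add_single (G : SimpleGraph V) (f : V → ℝ) (p : V) (t : ℝ) :
    triCount G (f + Pi.single p t) = triCount G f + 3 * t * linkCount G f p := by
  have hsum : ∑ x, f x * (adj G x p * codeg G f x p) = linkCount G f p := by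
    simp only [linkCount, adj_comm G p, codeg_comm G f p]
  rw [triCount, sum_add_single_mul, linkCount_add_single, adj_self]
  simp only [linkCount_add_single, mul_add, mul_left_comm _ (2 * t), Finset.sum_add_distrib,
    ← Finset.mul_sum, hsum]
  rw [triCount]
  ring

lemma energy_add_single (a b : ℝ) (G : SimpleGraph V) (f : V → ℝ) (p : V) (t : ℝ) :
    energy a b G (f + Pi.single p t) = energy a b G f + t * grad a b G f p := by
  simp only [energy, grad, edgeCount_add_single, triCount_add_single]
  ring

lemma grad_add_single (a b : ℝ) (G : SimpleGraph V) (f : V → ℝ) (p q : V) (t : ℝ) :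
    grad a b G (f + Pi.single q t) p = grad a b G f p + t * hess a b G f p q := by
  simp only [grad, hess, deg_add_single, linkCount_add_single]
  ring

end AddSingle

section Clique

lemma deg_of_isClique (hf : G.IsClique f.support) (hx : f x ≠ 0) :
    deg G f x = ∑ z, f z - f x := by
  classical
  simp only [deg, mul_adj_of_isClique hf hx, Finset.sum_sub_distrib, Finset.sum_ite_eq,
    Finset.mem_univ, if_true]

lemma codeg_of_isClique (hf : G.IsClique f.support) (hx : f x ≠ 0) (hy : f y ≠ 0) (hxy : x ≠ y) :
    codeg G f x y = ∑ z, f z - (f x + f y) := by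
  classical
  have hterm (z : V) : f z * (adj G x z * adj G y z) =
      f z * adj G y z - if x = z then f z else 0 := by
    rw [← mul_assoc, mul_adj_of_isClique hf hx, sub_mul]
    by_cases hxz : x = z
    · simp [← hxz, adj_of_adj (hf hy hx hxy.symm)]
    · simp [hxz]
  have hdeg := deg_of_isClique hf hy
  rw [deg] at hdeg
  simp only [codeg, hterm, Finset.sum_sub_distrib, hdeg, Finset.sum_ite_eq, Finset.mem_univ,
    if_true]
  ring

lemma linkCount_of_isClique (hf : G.IsClique f.support) (hx : f x ≠ 0) :
    linkCount G f x =
      (∑ z, f z - f x) * (∑ z, f z - 2 * f x) + (f x * ∑ z, f z - ∑ z, f z ^ 2) := by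
  classical
  have hterm (y : V) : f y * (adj G x y * codeg G f x y) =
      f y * (∑ z, f z - f x) - f y ^ 2 - if x = y then f x * (∑ z, f z - 2 * f x) else 0 := by
    rw [← mul_assoc, mul_adj_of_isClique hf hx]
    by_cases hxy : x = y
    · simp only [hxy, if_true]
      ring
    by_cases hy : f y = 0
    · simp [hxy, hy]
    · simp only [hxy, if_false, codeg_of_isClique hf hx hy hxy]
      ring
  simp only [linkCount, hterm, Finset.sum_sub_distrib, ← Finset.sum_mul, Finset.sum_ite_eq,
    Finset.mem_univ, if_true]
  ring

lemma edgeCount_of_isClique (hf : G.IsClique f.support) :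
    edgeCount G f = ∑ x, f x * (∑ z, f z - f x) := by
  refine Finset.sum_congr rfl fun x _ => ?_
  by_cases hx : f x = 0
  · simp only [hx, zero_mul]
  · rw [deg_of_isClique hf hx]

lemma triCount_of_isClique (hf : G.IsClique f.support) :
    triCount G f = ∑ x, f x * ((∑ z, f z - f x) * (∑ z, f z - 2 * f x)) := by
  have hterm (x : V) : f x * linkCount G f x = f x * ((∑ z, f z - f x) * (∑ z, f z - 2 * f x)) +
      (f x ^ 2 * ∑ z, f z - f x * ∑ z, f z ^ 2) := by
    by_cases hx : f x = 0
    · simp [hx]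
    · rw [linkCount_of_isClique hf hx]
      ring
  simp only [triCount, hterm, Finset.sum_add_distrib, Finset.sum_sub_distrib, ← Finset.sum_mul]
  ring

/-- The contribution of a vertex of weight `x` to the energy of a clique of total weight `s`. -/
def cliqueTerm (a b s x : ℝ) : ℝ :=
  x * (s - x) * (a + b * (s - 2 * x))

lemma energy_of_isClique (hf : G.IsClique f.support) :
    energy a b G f = ∑ x, cliqueTerm a b (∑ z, f z) (f x) := by
  rw [energy, edgeCount_of_isClique hf, triCount_of_isClique hf, Finset.mul_sum, Finset.mul_sum,
    ← Finset.sum_add_distrib]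
  refine Finset.sum_congr rfl fun x _ => ?_
  rw [cliqueTerm]
  ring

lemma hess_of_isClique (hf : G.IsClique f.support) (hp : f p ≠ 0) (hq : f q ≠ 0) (hpq : p ≠ q) :
    hess a b G f p q = 2 * a + 6 * b * (∑ z, f z - (f p + f q)) := by
  rw [hess_of_adj (hf hp hq hpq), codeg_of_isClique hf hp hq hpq]

end Clique

section Comap

variable {W : Type*}

open Classical in
/-- The number of preimages of a vertex under a colouring, as a weight function. -/
def fiberCard (c : V → W) (w : W) : ℕ :=
  (Finset.univ.filter fun v => c v = w).card

lemma fiberCard_ne_zero {c : V → W} {w : W} : fiberCard c w ≠ 0 ↔ w ∈ Set.range c := by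
  simp [fiberCard, Finset.filter_eq_empty_iff]

variable [Fintype W]

lemma sum_comp_eq_sum_fiberCard (c : V → W) (g : W → ℝ) :
    ∑ v, g (c v) = ∑ w, (fiberCard c w : ℝ) * g w := by
  classical
  rw [← Finset.sum_fiberwise Finset.univ c]
  refine Finset.sum_congr rfl fun w _ => ?_
  rw [Finset.sum_congr rfl fun v hv => congrArg g (Finset.mem_filter.1 hv).2, Finset.sum_const,
    nsmul_eq_mul, fiberCard]

lemma sum_fiberCard (c : V → W) : ∑ w, fiberCard c w = Fintype.card V := by
  have hone := sum_comp_eq_sum_fiberCard c fun _ => 1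
  simp only [mul_one, Finset.sum_const, Finset.card_univ, nsmul_eq_mul] at hone
  exact_mod_cast hone.symm

lemma deg_comap (c : V → W) (H : SimpleGraph W) (x : V) :
    deg (H.comap c) 1 x = deg H (fun w => fiberCard c w) (c x) := by
  simp only [deg, adj_comap, Pi.one_apply, one_mul, sum_comp_eq_sum_fiberCard c]

lemma codeg_comap (c : V → W) (H : SimpleGraph W) (x y : V) :
    codeg (H.comap c) 1 x y = codeg H (fun w => fiberCard c w) (c x) (c y) := by
  simp only [codeg, adj_comap, Pi.one_apply, one_mul,
    sum_comp_eq_sum_fiberCard c fun w => adj H (c x) w * adj H (c y) w]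

lemma edgeCount_comap (c : V → W) (H : SimpleGraph W) :
    edgeCount (H.comap c) 1 = edgeCount H fun w => fiberCard c w := by
  simp only [edgeCount, deg_comap, Pi.one_apply, one_mul,
    sum_comp_eq_sum_fiberCard c fun w => deg H (fun w => fiberCard c w) w]

lemma triCount_comap (c : V → W) (H : SimpleGraph W) :
    triCount (H.comap c) 1 = triCount H fun w => fiberCard c w := by
  simp only [triCount, linkCount, codeg_comap, adj_comap, Pi.one_apply, one_mul,
    sum_comp_eq_sum_fiberCard c fun w =>
      ∑ y, adj H w (c y) * codeg H (fun w => fiberCard c w) w (c y)]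
  refine Finset.sum_congr rfl fun w _ => ?_
  rw [sum_comp_eq_sum_fiberCard c fun y => adj H w y * codeg H (fun w => fiberCard c w) w y]

lemma energy_comap (a b : ℝ) (c : V → W) (H : SimpleGraph W) :
    energy a b (H.comap c) 1 = energy a b H fun w => fiberCard c w := by
  rw [energy, energy, edgeCount_comap, triCount_comap]

end Comap

end Weighted

/-! ### Natural weights of minimal energy -/

section MinWeight

variable {V : Type*} {G : SimpleGraph V} {μ : V → ℕ} {p q : V} {i j : ℕ}

lemma support_natCast (μ : V → ℕ) : (fun x => (μ x : ℝ)).support = μ.support := by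
  ext x
  simp

section SetPair

variable [DecidableEq V]

/-- The weight function `μ` with the weights of `p` and `q` replaced by `i` and `j`. -/
def setPair (μ : V → ℕ) (p q : V) (i j : ℕ) : V → ℕ :=
  Function.update (Function.update μ p i) q j

lemma setPair_left (hpq : p ≠ q) (μ : V → ℕ) (i j : ℕ) : setPair μ p q i j p = i := by
  simp [setPair, hpq]

lemma setPair_right (μ : V → ℕ) (p q : V) (i j : ℕ) : setPair μ p q i j q = j := by
  simp [setPair]

lemma setPair_of_ne {x : V} (hp : x ≠ p) (hq : x ≠ q) (μ : V → ℕ) (i j : ℕ) :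
    setPair μ p q i j x = μ x := by
  simp [setPair, hp, hq]

lemma cast_setPair (hpq : p ≠ q) (μ : V → ℕ) (i j : ℕ) :
    (fun x => (setPair μ p q i j x : ℝ)) =
      (fun x => (μ x : ℝ)) + Pi.single p (i - μ p : ℝ) + Pi.single q (j - μ q : ℝ) := by
  funext x
  by_cases hp : x = p
  · simp [hp, setPair_left hpq, hpq]
  by_cases hq : x = q
  · simp [hq, setPair_right, hpq.symm]
  · simp [setPair_of_ne hp hq, hp, hq]

lemma support_setPair_subset (hp : μ p ≠ 0) (hq : μ q ≠ 0) (i j : ℕ) :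
    (setPair μ p q i j).support ⊆ μ.support := fun x hx => by
  by_cases hxp : x = p
  · exact hxp ▸ hp
  by_cases hxq : x = q
  · exact hxq ▸ hq
  · rwa [Function.mem_support, setPair_of_ne hxp hxq] at hx

lemma support_setPair_zero_ssubset (hp : μ p ≠ 0) (hq : μ q ≠ 0) (i : ℕ) :
    (setPair μ p q i 0).support ⊂ μ.support :=
  (Set.ssubset_iff_of_subset (support_setPair_subset hp hq i 0)).2
    ⟨q, hq, fun h => h (setPair_right μ p q i 0)⟩

variable [Fintype V]

lemma sum_comp_setPair (hpq : p ≠ q) (μ : V → ℕ) (i j : ℕ) (g : ℕ → ℝ) :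
    ∑ x, g (setPair μ p q i j x) = ∑ x, g (μ x) + (g i - g (μ p)) + (g j - g (μ q)) := by
  have hterm (x : V) : g (setPair μ p q i j x) = g (μ x) +
      (if x = p then g i - g (μ p) else 0) + (if x = q then g j - g (μ q) else 0) := by
    by_cases hp : x = p
    · simp [hp, setPair_left hpq, hpq]
    by_cases hq : x = q
    · simp [hq, setPair_right, hpq.symm]
    · simp [setPair_of_ne hp hq, hp, hq]
  simp [hterm, Finset.sum_add_distrib]

lemma sum_cast_setPair (hpq : p ≠ q) (hij : i + j = μ p + μ q) :
    ∑ x, (setPair μ p q i j x : ℝ) = ∑ x, (μ x : ℝ) := by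
  have hij' : (i : ℝ) + j = μ p + μ q := by exact_mod_cast hij
  rw [sum_comp_setPair hpq μ i j fun k => (k : ℝ)]
  linarith

lemma sum_setPair (hpq : p ≠ q) (hij : i + j = μ p + μ q) :
    ∑ x, setPair μ p q i j x = ∑ x, μ x := by
  exact_mod_cast sum_cast_setPair hpq hij

lemma energy_setPair (a b : ℝ) (G : SimpleGraph V) (hpq : p ≠ q) (hij : i + j = μ p + μ q) :
    energy a b G (fun x => setPair μ p q i j x) = energy a b G (fun x => μ x) +
      (i - μ p) * (grad a b G (fun x => μ x) p - grad a b G (fun x => μ x) q) -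
      (i - μ p) ^ 2 * hess a b G (fun x => μ x) p q := by
  have hj : (j : ℝ) - μ q = -(i - μ p) := by
    have hij' : (i : ℝ) + j = μ p + μ q := by exact_mod_cast hij
    linarith
  rw [cast_setPair hpq, energy_add_single, energy_add_single, grad_add_single, hess_comm a b G _ q,
    hj]
  ring

lemma energy_setPair_of_isClique (a b : ℝ) (hμ : G.IsClique μ.support) (hp : μ p ≠ 0)
    (hq : μ q ≠ 0) (hpq : p ≠ q) (hij : i + j = μ p + μ q) :
    energy a b G (fun x => setPair μ p q i j x) = energy a b G (fun x => μ x) +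
      ((i : ℝ) * j - μ p * μ q) * hess a b G (fun x => μ x) p q := by
  have hclique (ν : V → ℕ) (hν : ν.support ⊆ μ.support) :
      G.IsClique (fun x => (ν x : ℝ)).support := by
    rw [support_natCast]
    exact hμ.subset hν
  have hj : (j : ℝ) = μ p + μ q - i := by
    have hij' : (i : ℝ) + j = μ p + μ q := by exact_mod_cast hij
    linarith
  rw [energy_of_isClique (hclique _ (support_setPair_subset hp hq i j)),
    energy_of_isClique (hclique _ subset_rfl), sum_cast_setPair hpq hij,
    sum_comp_setPair hpq μ i j fun k => cliqueTerm a b (∑ z, (μ z : ℝ)) k,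
    hess_of_isClique (hclique _ subset_rfl) (Nat.cast_ne_zero.2 hp) (Nat.cast_ne_zero.2 hq) hpq, hj]
  simp only [cliqueTerm]
  ring

end SetPair

variable [Fintype V] {a b : ℝ}

/-- `μ` has the least energy among the natural weight functions with the same total weight. -/
def IsMinWeight (a b : ℝ) (G : SimpleGraph V) (μ : V → ℕ) : Prop :=
  ∀ ν : V → ℕ, ∑ x, ν x = ∑ x, μ x → energy a b G (fun x => μ x) ≤ energy a b G fun x => ν x

lemma exists_isMinWeight (a b : ℝ) (G : SimpleGraph V) (μ : V → ℕ) :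
    ∃ ν : V → ℕ, ∑ x, ν x = ∑ x, μ x ∧ IsMinWeight a b G ν := by
  classical
  obtain ⟨ν, hν, hmin⟩ := Finset.exists_min_image (Finset.piAntidiag Finset.univ (∑ x, μ x))
    (fun ν => energy a b G fun x => ν x) ⟨μ, by simp⟩
  simp only [Finset.mem_piAntidiag, Finset.mem_univ, implies_true, and_true] at hν hmin
  exact ⟨ν, hν, fun ν' hν' => hmin ν' (hν'.trans hν)⟩

namespace IsMinWeight

lemma of_energy_eq (hμ : IsMinWeight a b G μ) {ν : V → ℕ} (hsum : ∑ x, ν x = ∑ x, μ x)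
    (henergy : energy a b G (fun x => ν x) = energy a b G (fun x => μ x)) :
    IsMinWeight a b G ν := fun ν' hν' =>
  henergy.trans_le (hμ ν' (hν'.trans hsum))

lemma grad_eq (hμ : IsMinWeight a b G μ) (hp : μ p ≠ 0) (hq : μ q ≠ 0) (hadj : ¬ G.Adj p q) :
    grad a b G (fun x => μ x) p = grad a b G (fun x => μ x) q := by
  classical
  have hle {x y : V} (hxy : x ≠ y) (hy : μ y ≠ 0) (hadj : ¬ G.Adj x y) :
      grad a b G (fun x => μ x) y ≤ grad a b G (fun x => μ x) x := by
    have hij : μ x + 1 + (μ y - 1) = μ x + μ y := by omega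
    have hmin := hμ _ (sum_setPair hxy hij)
    rw [energy_setPair a b G hxy hij, hess_of_not_adj hadj] at hmin
    push_cast at hmin
    linarith
  rcases eq_or_ne p q with rfl | hpq
  · rfl
  · exact le_antisymm (hle hpq.symm hp fun h => hadj h.symm) (hle hpq hq hadj)

lemma energy_setPair_of_not_adj [DecidableEq V] (hμ : IsMinWeight a b G μ) (hp : μ p ≠ 0)
    (hq : μ q ≠ 0) (hpq : p ≠ q) (hadj : ¬ G.Adj p q) (hij : i + j = μ p + μ q) :
    energy a b G (fun x => setPair μ p q i j x) = energy a b G fun x => μ x := by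
  rw [energy_setPair a b G hpq hij, hμ.grad_eq hp hq hadj, hess_of_not_adj hadj]
  ring

lemma setPair_of_not_adj [DecidableEq V] (hμ : IsMinWeight a b G μ) (hp : μ p ≠ 0) (hq : μ q ≠ 0)
    (hpq : p ≠ q) (hadj : ¬ G.Adj p q) (hij : i + j = μ p + μ q) :
    IsMinWeight a b G (setPair μ p q i j) :=
  hμ.of_energy_eq (sum_setPair hpq hij) (hμ.energy_setPair_of_not_adj hp hq hpq hadj hij)

lemma hess_nonpos (hμ : IsMinWeight a b G μ) (hclique : G.IsClique μ.support) (hp : μ p ≠ 0)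
    (hq : μ q ≠ 0) (hpq : p ≠ q) : hess a b G (fun x => μ x) p q ≤ 0 := by
  classical
  have hmin := hμ _ (sum_setPair hpq (add_zero (μ p + μ q)))
  rw [energy_setPair_of_isClique a b hclique hp hq hpq (add_zero _)] at hmin
  have hprod : (0 : ℝ) < μ p * μ q := by positivity
  push_cast at hmin
  nlinarith

lemma setPair_of_hess_eq_zero [DecidableEq V] (hμ : IsMinWeight a b G μ)
    (hclique : G.IsClique μ.support) (hp : μ p ≠ 0) (hq : μ q ≠ 0) (hpq : p ≠ q)
    (hhess : hess a b G (fun x => μ x) p q = 0) (hij : i + j = μ p + μ q) :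
    IsMinWeight a b G (setPair μ p q i j) := by
  refine hμ.of_energy_eq (sum_setPair hpq hij) ?_
  rw [energy_setPair_of_isClique a b hclique hp hq hpq hij, hhess, mul_zero, add_zero]

lemma le_add_one_of_hess_neg (hμ : IsMinWeight a b G μ) (hclique : G.IsClique μ.support)
    (hp : μ p ≠ 0) (hq : μ q ≠ 0) (hpq : p ≠ q) (hhess : hess a b G (fun x => μ x) p q < 0) :
    μ p ≤ μ q + 1 := by
  classical
  by_contra! hlt
  obtain ⟨i, hi⟩ : ∃ i, μ p = i + 1 := Nat.exists_eq_succ_of_ne_zero hp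
  have hij : i + (μ q + 1) = μ p + μ q := by omega
  have hmin := hμ _ (sum_setPair hpq hij)
  rw [energy_setPair_of_isClique a b hclique hp hq hpq hij] at hmin
  have hlt' : (μ q : ℝ) < i := by exact_mod_cast (by omega : μ q < i)
  push_cast [hi] at hmin
  nlinarith

lemma equitableOn (hμ : IsMinWeight a b G μ) (hclique : G.IsClique μ.support)
    (hhess : ∀ p q, μ p ≠ 0 → μ q ≠ 0 → p ≠ q → hess a b G (fun x => μ x) p q ≠ 0) :
    μ.support.EquitableOn μ := fun p q hp hq => by
  rcases eq_or_ne p q with rfl | hpq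
  · exact Nat.le_succ _
  · exact hμ.le_add_one_of_hess_neg hclique hp hq hpq
      ((hμ.hess_nonpos hclique hp hq hpq).lt_of_ne (hhess p q hp hq hpq))

end IsMinWeight

/-- Take `ν` of minimal support among the minimizers: if it failed to be an equitable clique, two of
its vertices could be merged. -/
theorem exists_isClique_equitableOn (a b : ℝ) (G : SimpleGraph V) (μ : V → ℕ) :
    ∃ ν : V → ℕ, ∑ x, ν x = ∑ x, μ x ∧ energy a b G (fun x => ν x) ≤ energy a b G (fun x => μ x) ∧
      G.IsClique ν.support ∧ ν.support.EquitableOn ν := by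
  classical
  obtain ⟨ν, ⟨hsum, hν⟩, hleast⟩ := (InvImage.wf (Function.support (ι := V) (M := ℕ))
    wellFounded_lt).has_min {ν | ∑ x, ν x = ∑ x, μ x ∧ IsMinWeight a b G ν}
    (exists_isMinWeight a b G μ)
  have hmerge {p q : V} (hp : ν p ≠ 0) (hq : ν q ≠ 0) (hpq : p ≠ q) :
      ¬ IsMinWeight a b G (setPair ν p q (ν p + ν q) 0) := fun h =>
    hleast _ ⟨(sum_setPair hpq (add_zero _)).trans hsum, h⟩ (support_setPair_zero_ssubset hp hq _)
  have hclique : G.IsClique ν.support := fun p hp q hq hpq => by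
    by_contra hadj
    exact hmerge hp hq hpq (hν.setPair_of_not_adj hp hq hpq hadj (add_zero _))
  exact ⟨ν, hsum, hν μ hsum.symm, hclique, hν.equitableOn hclique fun p q hp hq hpq h =>
    hmerge hp hq hpq (hν.setPair_of_hess_eq_zero hclique hp hq hpq h (add_zero _))⟩

end MinWeight

/-! ### Turán graphs minimize linear energies -/

section Turan

lemma sum_comp_of_equitableOn {ι : Type*} {s : Finset ι} {μ : ι → ℕ} (hμ : Set.EquitableOn s μ)
    (g : ℕ → ℝ) :
    ∑ i ∈ s, g (μ i) = s.card * g ((∑ i ∈ s, μ i) / s.card) +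
      ((∑ i ∈ s, μ i : ℕ) - s.card * ((∑ i ∈ s, μ i) / s.card : ℕ)) *
        (g ((∑ i ∈ s, μ i) / s.card + 1) - g ((∑ i ∈ s, μ i) / s.card)) := by
  have hvalue := Finset.equitableOn_iff.1 hμ
  set m := (∑ i ∈ s, μ i) / s.card
  have hterm (i : ι) (hi : i ∈ s) : g (μ i) = g m + (μ i - m) * (g (m + 1) - g m) := by
    rcases hvalue i hi with h | h <;> rw [h] <;> push_cast <;> ring
  rw [Finset.sum_congr rfl hterm, Finset.sum_add_distrib, ← Finset.sum_mul,
    Finset.sum_sub_distrib, Finset.sum_const, Finset.sum_const, nsmul_eq_mul, nsmul_eq_mul,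
    Nat.cast_sum]

lemma sum_comp_eq_of_equitableOn {ι κ : Type*} {s : Finset ι} {t : Finset κ} {μ : ι → ℕ}
    {ν : κ → ℕ} (hμ : Set.EquitableOn s μ) (hν : Set.EquitableOn t ν) (hcard : s.card = t.card)
    (hsum : ∑ i ∈ s, μ i = ∑ j ∈ t, ν j) (g : ℕ → ℝ) :
    ∑ i ∈ s, g (μ i) = ∑ j ∈ t, g (ν j) := by
  rw [sum_comp_of_equitableOn hμ, sum_comp_of_equitableOn hν, hcard, hsum]

variable (n r : ℕ) [NeZero r]

/-- The class of a vertex of the Turán graph `SimpleGraph.turanGraph n r`. -/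
def turanClass (x : Fin n) : Fin r := Fin.ofNat r x

lemma turanGraph_eq_comap :
    SimpleGraph.turanGraph n r = (⊤ : SimpleGraph (Fin r)).comap (turanClass n r) := by
  ext x y
  simp [SimpleGraph.turanGraph, turanClass, Fin.ext_iff]

/-- The sizes of the classes of the Turán graph `SimpleGraph.turanGraph n r`. -/
def classCard : Fin r → ℕ := fiberCard (turanClass n r)

lemma classCard_eq (i : Fin r) :
    classCard n r i = n / r + if (i : ℕ) < n % r then 1 else 0 := by
  have hcount := Nat.count_modEq_card n (NeZero.pos r) i
  rw [Nat.mod_eq_of_lt i.2] at hcount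
  rw [← hcount, Nat.count_eq_card_filter_range, classCard, fiberCard]
  refine Finset.card_bij (fun x _ => (x : ℕ)) (fun x hx => ?_) (fun x _ y _ => Fin.ext)
    fun y hy => ?_
  · simp only [Finset.mem_filter, Finset.mem_univ, true_and, turanClass, Fin.ext_iff,
      Fin.val_ofNat] at hx
    simp [Nat.ModEq, hx, Nat.mod_eq_of_lt i.2]
  · simp only [Finset.mem_filter, Finset.mem_range, Nat.ModEq, Nat.mod_eq_of_lt i.2] at hy
    exact ⟨⟨y, hy.1⟩, by simp [turanClass, Fin.ext_iff, hy.2], rfl⟩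

lemma equitableOn_classCard : Set.univ.EquitableOn (classCard n r) := fun i j _ _ => by
  rw [classCard_eq, classCard_eq]
  split_ifs <;> omega

lemma sum_classCard : ∑ i, classCard n r i = n := by
  simpa only [classCard, Fintype.card_fin] using sum_fiberCard (turanClass n r)

lemma energy_turanGraph (a b : ℝ) :
    energy a b (SimpleGraph.turanGraph n r) 1 = ∑ i, cliqueTerm a b n (classCard n r i) := by
  have hsum : ∑ i, (fiberCard (turanClass n r) i : ℝ) = n := mod_cast sum_classCard n r
  rw [turanGraph_eq_comap, energy_comap, energy_of_isClique fun i _ j _ => id, hsum, classCard]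

theorem exists_energy_turanGraph_le (a b : ℝ) {n : ℕ} (hn : n ≠ 0) (G : SimpleGraph (Fin n)) :
    ∃ k < n, energy a b (SimpleGraph.turanGraph n (k + 1)) 1 ≤ energy a b G 1 := by
  obtain ⟨ν, hsum, hle, hclique, hν⟩ := exists_isClique_equitableOn a b G 1
  simp only [Pi.one_apply, Nat.cast_one, Finset.sum_const, Finset.card_univ, Fintype.card_fin,
    smul_eq_mul, mul_one] at hsum hle
  set s : Finset (Fin n) := Finset.univ.filter fun x => ν x ≠ 0
  have hsum_s : ∑ x ∈ s, ν x = n := (Finset.sum_filter_ne_zero _).trans hsum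
  obtain ⟨k, hk⟩ : ∃ k, s.card = k + 1 := by
    refine Nat.exists_eq_succ_of_ne_zero fun hcard => hn ?_
    rw [← hsum_s, Finset.card_eq_zero.1 hcard, Finset.sum_empty]
  have hkn : s.card ≤ n := (Finset.card_le_univ s).trans_eq (Fintype.card_fin n)
  refine ⟨k, by omega, le_trans (le_of_eq ?_) hle⟩
  calc
    energy a b (SimpleGraph.turanGraph n (k + 1)) 1
      = ∑ i, cliqueTerm a b n (classCard n (k + 1) i) := energy_turanGraph n (k + 1) a b
    _ = ∑ x ∈ s, cliqueTerm a b n (ν x) := by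
      refine sum_comp_eq_of_equitableOn (g := fun m => cliqueTerm a b n m)
        (by simpa using equitableOn_classCard n (k + 1))
        (by simpa [s, Function.support] using hν) ?_ ?_
      · rw [Finset.card_univ, Fintype.card_fin, hk]
      · rw [sum_classCard, hsum_s]
    _ = ∑ x, cliqueTerm a b n (ν x) := by
      refine Finset.sum_filter_of_ne fun x _ => mt fun hx => ?_
      simp [cliqueTerm, hx]
    _ = energy a b G fun x => ν x := by
      rw [energy_of_isClique (by rwa [support_natCast]), ← Nat.cast_sum, hsum]

end Turan

/-! ### Density vectors -/

section Density

variable {n : ℕ}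

lemma card_hom_eq_sum_prod_indicator {m : ℕ} (H : SimpleGraph (Fin m)) [DecidableRel H.Adj]
    (G : SimpleGraph (Fin n)) :
    (Nat.card (H →g G) : ℝ) =
      ∑ g : Fin m → Fin n, ∏ e ∈ H.edgeFinset, G.edgeSet.indicator 1 (e.map g) := by
  classical
  have hterm (g : Fin m → Fin n) :
      ∏ e ∈ H.edgeFinset, G.edgeSet.indicator (1 : Sym2 (Fin n) → ℝ) (e.map g) =
        if ∀ e ∈ H.edgeFinset, e.map g ∈ G.edgeSet then 1 else 0 := by
    simp only [Set.indicator_apply, Pi.one_apply, Finset.prod_boole]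
    congr
  rw [Finset.sum_congr rfl fun g _ => hterm g, Finset.sum_boole, Nat.cast_inj,
    ← Fintype.card_subtype, ← Nat.card_eq_fintype_card]
  exact Nat.card_congr
    { toFun := fun f =>
        ⟨f, fun e he => (f.mapEdgeSet ⟨e, SimpleGraph.mem_edgeFinset.1 he⟩).2⟩
      invFun := fun g => ⟨g.1, fun h => g.2 s(_, _) (SimpleGraph.mem_edgeFinset.2 h)⟩
      left_inv := fun _ => rfl
      right_inv := fun _ => rfl }

lemma edgeFinset_top_fin_two : (⊤ : SimpleGraph (Fin 2)).edgeFinset = {s(0, 1)} := by decide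

lemma edgeFinset_top_fin_three :
    (⊤ : SimpleGraph (Fin 3)).edgeFinset = {s(0, 1), s(0, 2), s(1, 2)} := by decide

lemma homDensity_top_fin_two (G : SimpleGraph (Fin n)) :
    homDensity (⊤ : SimpleGraph (Fin 2)) G = edgeCount G 1 / (n : ℝ) ^ 2 := by
  rw [homDensity, card_hom_eq_sum_prod_indicator, edgeFinset_top_fin_two,
    ← (finTwoArrowEquiv (Fin n)).symm.sum_comp, Fintype.sum_prod_type]
  simp [edgeCount, deg, adj]

lemma homDensity_top_fin_three (G : SimpleGraph (Fin n)) :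
    homDensity (⊤ : SimpleGraph (Fin 3)) G = triCount G 1 / (n : ℝ) ^ 3 := by
  rw [homDensity, card_hom_eq_sum_prod_indicator, edgeFinset_top_fin_three,
    ← (Fin.consEquiv fun _ => Fin n).sum_comp, Fintype.sum_prod_type]
  simp only [← (finTwoArrowEquiv (Fin n)).symm.sum_comp, Fintype.sum_prod_type]
  simp [triCount, linkCount, codeg, adj, Finset.mul_sum]

lemma tGraph_eq (G : SimpleGraph (Fin n)) :
    tGraph G = !₂[edgeCount G 1 / (n : ℝ) ^ 2, triCount G 1 / (n : ℝ) ^ 3] := by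
  rw [tGraph, homDensity_top_fin_two, homDensity_top_fin_three]

/-- The point `(1 - x, (1 - x)(1 - 2x))`: at `x = 1 / r`, the density vector of the limit of
complete `r`-partite graphs with equal classes. -/
def turanPoint (x : ℝ) : EuclideanSpace ℝ (Fin 2) :=
  !₂[1 - x, (1 - x) * (1 - 2 * x)]

theorem tGraph_comap_top {W : Type*} [Fintype W] (hn : n ≠ 0) (c : Fin n → W) :
    tGraph ((⊤ : SimpleGraph W).comap c) =
      ∑ w, ((fiberCard c w : ℝ) / n) • turanPoint ((fiberCard c w : ℝ) / n) := by
  have hclique : (⊤ : SimpleGraph W).IsClique (fun w => (fiberCard c w : ℝ)).support :=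
    fun i _ j _ => id
  have hsum : ∑ w, (fiberCard c w : ℝ) = n := by
    exact_mod_cast (sum_fiberCard c).trans (Fintype.card_fin n)
  rw [tGraph_eq, edgeCount_comap, triCount_comap, edgeCount_of_isClique hclique,
    triCount_of_isClique hclique, hsum]
  ext i
  fin_cases i <;>
  · simp only [Finset.sum_div, Fin.zero_eta, Fin.mk_one, Matrix.cons_val_zero,
      Matrix.cons_val_one, Matrix.cons_val_fin_one, turanPoint, WithLp.ofLp_sum, WithLp.ofLp_smul,
      Matrix.smul_cons, smul_eq_mul, Matrix.smul_empty, Finset.sum_apply]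
    refine Finset.sum_congr rfl fun w _ => ?_
    field_simp

lemma tGraph_comap_top_of_fiberCard_eq {W : Type*} (hn : n ≠ 0) {c : Fin n → W}
    {C : ℕ} (hc : ∀ w, fiberCard c w = C) :
    tGraph ((⊤ : SimpleGraph W).comap c) = turanPoint (C / n) := by
  have hC : C ≠ 0 := hc (c ⟨0, Nat.pos_of_ne_zero hn⟩) ▸ fiberCard_ne_zero.2 ⟨_, rfl⟩
  have hsurj : c.Surjective := fun w => fiberCard_ne_zero.1 ((hc w).symm ▸ hC)
  have : Fintype W := @Fintype.ofFinite W (.of_surjective c hsurj)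
  have hcard : (Fintype.card W : ℝ) * C = n := by
    have hsum := sum_fiberCard c
    simp only [hc, Finset.sum_const, Finset.card_univ, smul_eq_mul, Fintype.card_fin] at hsum
    exact_mod_cast hsum
  simp only [tGraph_comap_top hn, hc, ← Finset.sum_smul, Finset.sum_const, Finset.card_univ,
    nsmul_eq_mul]
  rw [← mul_div_assoc, hcard, div_self (Nat.cast_ne_zero.2 hn), one_smul]

end Density

/-! ### Vertices of the polytopes -/

section Polygon

variable {n k : ℕ}

lemma vn_eq_sum (hn : n ≠ 0) (k : ℕ) :
    vn k n = ∑ i, ((classCard n (k + 1) i : ℝ) / n) •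
      turanPoint ((classCard n (k + 1) i : ℝ) / n) := by
  rw [vn, turanGraph_eq_comap, tGraph_comap_top hn]
  rfl

lemma vn_of_dvd (hn : n ≠ 0) (h : k + 1 ∣ n) : vn k n = turanPoint (1 / (k + 1)) := by
  obtain ⟨m, rfl⟩ := h
  have hm : (m : ℝ) ≠ 0 := by exact_mod_cast right_ne_zero_of_mul hn
  have hclass (i : Fin (k + 1)) : fiberCard (turanClass ((k + 1) * m) (k + 1)) i = m := by
    rw [← classCard, classCard_eq, Nat.mul_mod_right, if_neg (Nat.not_lt_zero _), add_zero,
      Nat.mul_div_cancel_left _ k.succ_pos]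
  rw [vn, turanGraph_eq_comap, tGraph_comap_top_of_fiberCard_eq hn hclass]
  congr 1
  push_cast
  field_simp

lemma classCard_eq_one_or_two (hk : k < n) (hn : n ≤ 2 * (k + 1)) (i : Fin (k + 1)) :
    classCard n (k + 1) i = 1 ∨ classCard n (k + 1) i = 2 := by
  rw [classCard_eq]
  rcases hn.lt_or_eq with hlt | rfl
  · rw [Nat.div_eq_of_lt_le (k := 1) (by omega) (by omega)]
    split_ifs <;> simp
  · rw [Nat.mul_mod_left, Nat.mul_div_cancel _ k.succ_pos]
    simp

lemma vn_eq_lineMap (hk : k < n) (hn : n ≤ 2 * (k + 1)) :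
    vn k n = AffineMap.lineMap (turanPoint (2 / n)) (turanPoint (1 / n))
      ((2 * (k + 1) - n : ℝ) / n) := by
  have hn0 : n ≠ 0 := by omega
  have hn0' : (n : ℝ) ≠ 0 := by exact_mod_cast hn0
  have hterm (i : Fin (k + 1)) :
      ((classCard n (k + 1) i : ℝ) / n) • turanPoint ((classCard n (k + 1) i : ℝ) / n) =
        (2 * (classCard n (k + 1) i - 1 : ℝ) / n) • turanPoint (2 / n) +
          ((2 - classCard n (k + 1) i : ℝ) / n) • turanPoint (1 / n) := by
    rcases classCard_eq_one_or_two hk hn i with h | h <;> rw [h] <;> norm_num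
  have hsum : ∑ i, (classCard n (k + 1) i : ℝ) = n := by exact_mod_cast sum_classCard n (k + 1)
  simp only [vn_eq_sum hn0, hterm, Finset.sum_add_distrib, ← Finset.sum_smul, ← Finset.sum_div,
    ← Finset.mul_sum, Finset.sum_sub_distrib, hsum, Finset.sum_const, Finset.card_univ,
    Fintype.card_fin, nsmul_eq_mul, AffineMap.lineMap_apply_module]
  congr 2 <;> push_cast <;> (field_simp; try ring)

lemma vn_mem_segment {c : ℕ} (hc : n ≤ 2 * (c + 1)) (hck : c ≤ k) (hk : k < n) :
    vn k n ∈ segment ℝ (vn c n) (vn (n - 1) n) := by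
  rw [vn_eq_lineMap hk (by omega), vn_eq_lineMap (k := c) (by omega) hc,
    vn_eq_lineMap (k := n - 1) (by omega) (by omega), ← image_segment]
  refine Set.mem_image_of_mem _ ?_
  rw [segment_eq_Icc (by gcongr; omega)]
  constructor <;> gcongr
  omega

/-- The points whose convex hull is claimed to be `Pn n`. -/
def vertexSet (n : ℕ) : Set (EuclideanSpace ℝ (Fin 2)) :=
  {x | ∃ k : ℕ, k < ⌈(n : ℝ) / 2⌉₊ ∧ x = vn k n} ∪ {vn (n - 1) n}

lemma finite_vertexSet (n : ℕ) : (vertexSet n).Finite := by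
  refine Set.Finite.union ?_ (Set.finite_singleton _)
  refine ((Set.finite_lt_nat ⌈(n : ℝ) / 2⌉₊).image fun k => vn k n).subset ?_
  rintro x ⟨k, hk, rfl⟩
  exact ⟨k, hk, rfl⟩

lemma vn_mem_convexHull_vertexSet (hk : k < n) : vn k n ∈ convexHull ℝ (vertexSet n) := by
  have hvertex {c : ℕ} (hc : c < ⌈(n : ℝ) / 2⌉₊) : vn c n ∈ vertexSet n := Or.inl ⟨c, hc, rfl⟩
  by_cases hceil : k < ⌈(n : ℝ) / 2⌉₊
  · exact subset_convexHull ℝ _ (hvertex hceil)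
  obtain ⟨c, hc⟩ : ∃ c, ⌈(n : ℝ) / 2⌉₊ = c + 1 :=
    Nat.exists_eq_succ_of_ne_zero (Nat.ceil_pos.2 (by have := hk.pos; positivity)).ne'
  have hn : n ≤ 2 * (c + 1) := by
    have hle : (n : ℝ) / 2 ≤ (c + 1 : ℕ) := hc ▸ Nat.le_ceil _
    rw [div_le_iff₀' two_pos] at hle
    exact_mod_cast hle
  exact (convex_convexHull ℝ _).segment_subset (subset_convexHull ℝ _ (hvertex (by omega)))
    (subset_convexHull ℝ _ (Or.inr rfl)) (vn_mem_segment hn (by omega) hk)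

lemma mem_of_forall_exists_clm_le {E : Type*} [TopologicalSpace E] [AddCommGroup E] [Module ℝ E]
    [IsTopologicalAddGroup E] [ContinuousSMul ℝ E] [LocallyConvexSpace ℝ E] {K : Set E} {x : E}
    (hconvex : Convex ℝ K) (hclosed : IsClosed K)
    (h : ∀ φ : E →L[ℝ] ℝ, ∃ y ∈ K, φ y ≤ φ x) : x ∈ K := by
  by_contra hx
  obtain ⟨φ, u, hxu, hu⟩ := geometric_hahn_banach_point_closed hconvex hclosed hx
  obtain ⟨y, hy, hyx⟩ := h φ
  linarith [hu y hy]

lemma clm_euclidean_two (φ : EuclideanSpace ℝ (Fin 2) →L[ℝ] ℝ) (s t : ℝ) :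
    φ !₂[s, t] = s * φ !₂[1, 0] + t * φ !₂[0, 1] := by
  have hbasis : (!₂[s, t] : EuclideanSpace ℝ (Fin 2)) = s • !₂[1, 0] + t • !₂[0, 1] := by
    ext i
    fin_cases i <;> simp
  rw [hbasis, map_add, map_smul, map_smul, smul_eq_mul, smul_eq_mul]

lemma clm_tGraph (φ : EuclideanSpace ℝ (Fin 2) →L[ℝ] ℝ) (G : SimpleGraph (Fin n)) :
    φ (tGraph G) = energy (φ !₂[1, 0] / (n : ℝ) ^ 2) (φ !₂[0, 1] / (n : ℝ) ^ 3) G 1 := by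
  rw [tGraph_eq, clm_euclidean_two, energy]
  ring

theorem Pn_eq_convexHull_vertexSet (hn : n ≠ 0) : Pn n = convexHull ℝ (vertexSet n) := by
  refine subset_antisymm (convexHull_min ?_ (convex_convexHull ℝ _)) (convexHull_mono ?_)
  · rintro _ ⟨G, rfl⟩
    refine mem_of_forall_exists_clm_le (convex_convexHull ℝ _)
      ((finite_vertexSet n).isClosed_convexHull ℝ) fun φ => ?_
    obtain ⟨k, hk, hle⟩ := exists_energy_turanGraph_le (φ !₂[1, 0] / (n : ℝ) ^ 2)
      (φ !₂[0, 1] / (n : ℝ) ^ 3) hn G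
    exact ⟨vn k n, vn_mem_convexHull_vertexSet hk, by rwa [vn, clm_tGraph, clm_tGraph]⟩
  · rintro x (⟨k, -, rfl⟩ | rfl) <;> exact Set.mem_range_self _

end Polygon

/-! ### Density vectors on a chord -/

section Merge

variable {V : Type*} {G : SimpleGraph V} {μ : V → ℕ} {u v w p q : V}

lemma setPair_add_zero_ne_zero [DecidableEq V] (hpq : p ≠ q) (hu : μ u ≠ 0) (hqu : q ≠ u) :
    setPair μ p q (μ p + μ q) 0 u ≠ 0 := by
  by_cases hpu : u = p
  · rw [hpu, setPair_left hpq, ← hpu]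
    omega
  · rwa [setPair_of_ne hpu hqu.symm]

lemma adj_mul_adj_le_of_not_adj (huw : G.Adj u w) (hpq : p ≠ q) (hadj : ¬ G.Adj p q) :
    (q ≠ u ∧ q ≠ w ∧ adj G u q * adj G w q ≤ adj G u p * adj G w p) ∨
      (p ≠ u ∧ p ≠ w ∧ adj G u p * adj G w p ≤ adj G u q * adj G w q) := by
  have hnonneg (x : V) : 0 ≤ adj G u x * adj G w x := mul_nonneg (adj_nonneg ..) (adj_nonneg ..)
  have hadj' : ¬ G.Adj q p := fun h => hadj h.symm
  rcases eq_or_ne p u with rfl | hpu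
  · exact Or.inl ⟨hpq.symm, by rintro rfl; exact hadj huw,
      by simpa only [adj_of_not_adj hadj, zero_mul] using hnonneg p⟩
  rcases eq_or_ne p w with rfl | hpw
  · exact Or.inl ⟨by rintro rfl; exact hadj' huw, hpq.symm,
      by simpa only [adj_of_not_adj hadj, mul_zero] using hnonneg p⟩
  rcases eq_or_ne q u with rfl | hqu
  · exact Or.inr ⟨hpu, hpw, by simpa only [adj_of_not_adj hadj', zero_mul] using hnonneg q⟩
  rcases eq_or_ne q w with rfl | hqw
  · exact Or.inr ⟨hpu, hpw, by simpa only [adj_of_not_adj hadj', mul_zero] using hnonneg q⟩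
  · exact (le_total _ _).imp (⟨hqu, hqw, ·⟩) (⟨hpu, hpw, ·⟩)

variable [Fintype V] {a b : ℝ}

lemma codeg_le_codeg_setPair_add_zero [DecidableEq V] (hpq : p ≠ q)
    (hle : adj G u q * adj G w q ≤ adj G u p * adj G w p) :
    codeg G (fun x => μ x) u w ≤ codeg G (fun x => setPair μ p q (μ p + μ q) 0 x) u w := by
  have hmul := mul_le_mul_of_nonneg_left hle (μ q).cast_nonneg (α := ℝ)
  rw [cast_setPair hpq, codeg_add_single, codeg_add_single]
  push_cast
  linarith

namespace IsMinWeight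

lemma energy_eq (hμ : IsMinWeight a b G μ) {ν : V → ℕ} (hν : IsMinWeight a b G ν)
    (hsum : ∑ x, ν x = ∑ x, μ x) :
    energy a b G (fun x => ν x) = energy a b G (fun x => μ x) :=
  le_antisymm (hν μ hsum.symm) (hμ ν hsum)

lemma exists_isClique_codeg_le (hμ : IsMinWeight a b G μ) (hu : μ u ≠ 0) (hw : μ w ≠ 0)
    (huw : G.Adj u w) :
    ∃ ν : V → ℕ, ∑ x, ν x = ∑ x, μ x ∧ IsMinWeight a b G ν ∧ ν u ≠ 0 ∧ ν w ≠ 0 ∧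
      codeg G (fun x => μ x) u w ≤ codeg G (fun x => ν x) u w ∧ G.IsClique ν.support := by
  classical
  obtain ⟨ν, ⟨hsum, hν, hνu, hνw, hcodeg⟩, hleast⟩ :=
    (InvImage.wf (Function.support (ι := V) (M := ℕ)) wellFounded_lt).has_min
      {ν | ∑ x, ν x = ∑ x, μ x ∧ IsMinWeight a b G ν ∧ ν u ≠ 0 ∧ ν w ≠ 0 ∧
        codeg G (fun x => μ x) u w ≤ codeg G (fun x => ν x) u w} ⟨μ, rfl, hμ, hu, hw, le_rfl⟩
  refine ⟨ν, hsum, hν, hνu, hνw, hcodeg, ?_⟩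
  have hmerge {p q : V} (hp : ν p ≠ 0) (hq : ν q ≠ 0) (hpq : p ≠ q) (hadj : ¬ G.Adj p q)
      (hqu : q ≠ u) (hqw : q ≠ w) : ¬ adj G u q * adj G w q ≤ adj G u p * adj G w p := fun hle =>
    hleast (setPair ν p q (ν p + ν q) 0)
      ⟨(sum_setPair hpq (add_zero _)).trans hsum, hν.setPair_of_not_adj hp hq hpq hadj (add_zero _),
        setPair_add_zero_ne_zero hpq hνu hqu, setPair_add_zero_ne_zero hpq hνw hqw,
        hcodeg.trans (codeg_le_codeg_setPair_add_zero hpq hle)⟩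
      (support_setPair_zero_ssubset hp hq _)
  intro p hp q hq hpq
  by_contra hadj
  rcases adj_mul_adj_le_of_not_adj huw hpq hadj with ⟨hqu, hqw, hle⟩ | ⟨hpu, hpw, hle⟩
  · exact hmerge hp hq hpq hadj hqu hqw hle
  · exact hmerge hq hp hpq.symm (fun h => hadj h.symm) hpu hpw hle

/-- Shifting weight from `w` to `v` gives another weight of minimal energy, and there the partial
derivatives at `u` and `v` still agree. -/
lemma hess_eq_zero_of_not_adj (hμ : IsMinWeight a b G μ) (hu : μ u ≠ 0) (hv : μ v ≠ 0)
    (hw : μ w ≠ 0) (hvu : ¬ G.Adj v u) (hvw : ¬ G.Adj v w) :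
    hess a b G (fun x => μ x) u w = 0 := by
  classical
  by_cases huw : G.Adj u w
  swap
  · exact hess_of_not_adj huw
  have hne : v ≠ w := by
    rintro rfl
    exact hvu huw.symm
  have hgrad := hμ.grad_eq hv hu hvu
  have hgrad_shift := (hμ.setPair_of_not_adj hv hw hne hvw (add_zero _)).grad_eq
    (setPair_add_zero_ne_zero hne hv hne.symm) (setPair_add_zero_ne_zero hne hu huw.ne') hvu
  have huv : adj G u v = 0 := adj_of_not_adj fun h => hvu h.symm
  have hhess (t : ℝ) : hess a b G ((fun x => (μ x : ℝ)) + Pi.single v t) u w =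
      hess a b G (fun x => μ x) u w := by
    rw [hess, hess, codeg_add_single, huv, zero_mul, mul_zero, add_zero]
  have hμw : (μ w : ℝ) ≠ 0 := Nat.cast_ne_zero.2 hw
  rw [cast_setPair hne, grad_add_single, grad_add_single, grad_add_single, grad_add_single, hgrad,
    hess_of_not_adj G.irrefl, hess_comm _ _ _ _ u v, hess_of_not_adj hvu, hess_of_not_adj hvw,
    hhess] at hgrad_shift
  simpa [hμw] using hgrad_shift

end IsMinWeight

end Merge

section Chord

universe u

variable {V : Type*} {μ : V → ℕ} {n A B r : ℕ}

/-- The cubic `x (x - A) (x - B)`, which is negative exactly on the gap between `B` and `A` as far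
as positive arguments are concerned. -/
def gapCubic (A B x : ℕ) : ℝ :=
  x * ((x - A) * (x - B))

lemma gapCubic_eq_zero {x : ℕ} : gapCubic A B x = 0 ↔ x = 0 ∨ x = A ∨ x = B := by
  simp only [gapCubic, mul_eq_zero, sub_eq_zero, Nat.cast_inj, Nat.cast_eq_zero]

lemma gapCubic_nonneg {x : ℕ} (hBA : B ≤ A) (hx : A ≤ x ∨ x ≤ B) : 0 ≤ gapCubic A B x := by
  refine mul_nonneg x.cast_nonneg ?_
  have hBA' : (B : ℝ) ≤ A := by exact_mod_cast hBA
  rcases hx with hx | hx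
  · have hx' : (A : ℝ) ≤ x := by exact_mod_cast hx
    exact mul_nonneg (by linarith) (by linarith)
  · have hx' : (x : ℝ) ≤ B := by exact_mod_cast hx
    exact mul_nonneg_of_nonpos_of_nonpos (by linarith) (by linarith)

lemma gapCubic_nonneg_of_forall (hBA : B ≤ A)
    (hμ : (∀ x, μ x ≠ 0 → A ≤ μ x) ∨ ∀ x, μ x ≠ 0 → μ x ≤ B) (x : V) :
    0 ≤ gapCubic A B (μ x) := by
  by_cases hx : μ x = 0
  · exact (gapCubic_eq_zero.2 (Or.inl hx)).ge
  · exact gapCubic_nonneg hBA (hμ.imp (· x hx) (· x hx))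

lemma forall_le_or_forall_le_of_equitableOn {ι : Type*} {s : Finset ι} {μ : ι → ℕ}
    (hμ : Set.EquitableOn s μ) (hA : r * A = ∑ i ∈ s, μ i) (hB : (r + 1) * B = ∑ i ∈ s, μ i) :
    (∀ i ∈ s, A ≤ μ i) ∨ ∀ i ∈ s, μ i ≤ B := by
  rcases Nat.lt_or_ge r s.card with hr | hr
  · refine Or.inr fun i hi => ?_
    by_contra! hlt
    have hsum : ∑ _j ∈ s, B < ∑ j ∈ s, μ j :=
      Finset.sum_lt_sum (fun j hj => Nat.le_of_lt_succ (hlt.trans_le (hμ hi hj))) ⟨i, hi, hlt⟩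
    rw [Finset.sum_const, smul_eq_mul, ← hB] at hsum
    exact hsum.not_ge (Nat.mul_le_mul_right B hr)
  · refine Or.inl fun i hi => le_trans ?_ (Finset.EquitableOn.le hμ hi)
    rw [Nat.le_div_iff_mul_le (Finset.card_pos.2 ⟨i, hi⟩), ← hA, mul_comm]
    exact Nat.mul_le_mul_right A hr

variable [Fintype V] {G : SimpleGraph V} {p q : V}

/-- The coefficient `a` for which the energy `a * edgeCount + triCount` is constant on the chord
through the complete multipartite graphs on `n` vertices with classes of size `A`, respectively
`B`. -/
def chordCoeff (n A B : ℕ) : ℝ :=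
  2 * (A + B) - 3 * n

/-- The energy of slope `chordCoeff n A B`, normalized to vanish on the chord. -/
def chordEnergy (n A B : ℕ) (G : SimpleGraph V) (f : V → ℝ) : ℝ :=
  energy (chordCoeff n A B) 1 G f - (chordCoeff n A B * n ^ 2 + n ^ 3 - 2 * A * B * n)

lemma chordEnergy_of_isClique (hclique : G.IsClique μ.support) (hsum : ∑ x, μ x = n) :
    chordEnergy n A B G (fun x => μ x) = 2 * ∑ x, gapCubic A B (μ x) := by
  have hsum' : ∑ x, (μ x : ℝ) = n := by exact_mod_cast hsum
  have hterm (x : V) : cliqueTerm (chordCoeff n A B) 1 n (μ x) =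
      2 * gapCubic A B (μ x) + (chordCoeff n A B * n + n ^ 2 - 2 * A * B) * μ x := by
    rw [cliqueTerm, chordCoeff, gapCubic]
    ring
  rw [chordEnergy, energy_of_isClique (by rwa [support_natCast]), hsum',
    Finset.sum_congr rfl fun x _ => hterm x, Finset.sum_add_distrib, ← Finset.mul_sum,
    ← Finset.mul_sum, hsum']
  ring

lemma forall_le_or_forall_le (hA : r * A = n) (hB : (r + 1) * B = n) (hsum : ∑ x, μ x = n)
    (hμ : μ.support.EquitableOn μ) :
    (∀ x, μ x ≠ 0 → A ≤ μ x) ∨ ∀ x, μ x ≠ 0 → μ x ≤ B := by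
  have hsum' : ∑ x with μ x ≠ 0, μ x = n := (Finset.sum_filter_ne_zero _).trans hsum
  simpa using forall_le_or_forall_le_of_equitableOn (s := {x | μ x ≠ 0})
    (by simpa [Function.support] using hμ) (hA.trans hsum'.symm) (hB.trans hsum'.symm)

lemma chordEnergy_nonneg (hA : r * A = n) (hB : (r + 1) * B = n) (hBA : B ≤ A)
    (G : SimpleGraph V) (hsum : ∑ x, μ x = n) : 0 ≤ chordEnergy n A B G fun x => μ x := by
  obtain ⟨ν, hν, hle, hclique, hequitable⟩ := exists_isClique_equitableOn (chordCoeff n A B) 1 G μ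
  have hcases := forall_le_or_forall_le hA hB (hν.trans hsum) hequitable
  refine le_trans ?_ (sub_le_sub_right hle _)
  rw [← chordEnergy, chordEnergy_of_isClique hclique (hν.trans hsum)]
  exact mul_nonneg zero_le_two
    (Finset.sum_nonneg fun x _ => gapCubic_nonneg_of_forall hBA hcases x)

lemma isMinWeight_of_chordEnergy_eq_zero (hA : r * A = n) (hB : (r + 1) * B = n) (hBA : B ≤ A)
    (hsum : ∑ x, μ x = n) (hzero : chordEnergy n A B G (fun x => μ x) = 0) :
    IsMinWeight (chordCoeff n A B) 1 G μ := fun ν hν => by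
  have hnonneg := chordEnergy_nonneg hA hB hBA G (hν.trans hsum)
  rw [chordEnergy] at hzero hnonneg
  linarith

lemma hess_chordCoeff_of_isClique (hclique : G.IsClique μ.support) (hsum : ∑ x, μ x = n)
    (hp : μ p ≠ 0) (hq : μ q ≠ 0) (hpq : p ≠ q) :
    hess (chordCoeff n A B) 1 G (fun x => μ x) p q = 4 * (A + B) - 6 * (μ p + μ q) := by
  have hsum' : ∑ x, (μ x : ℝ) = n := by exact_mod_cast hsum
  rw [hess_of_isClique (f := fun x => (μ x : ℝ)) (by rwa [support_natCast]) (Nat.cast_ne_zero.2 hp)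
    (Nat.cast_ne_zero.2 hq) hpq, hsum', chordCoeff]
  ring

/-- If the Hessian entry at `p` and `q` vanished, merging these two vertices would give a clique of
chord energy zero with a vertex of weight `2 (A + B) / 3 > A`, hence with all weights at least `A`
and positive chord energy. -/
lemma hess_neg_of_isMinWeight (hBA : B ≤ A) (hAB : A < 2 * B)
    (hμ : IsMinWeight (chordCoeff n A B) 1 G μ) (hsum : ∑ x, μ x = n)
    (hzero : chordEnergy n A B G (fun x => μ x) = 0) (hclique : G.IsClique μ.support)
    (hp : μ p ≠ 0) (hq : μ q ≠ 0) (hpq : p ≠ q) :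
    hess (chordCoeff n A B) 1 G (fun x => μ x) p q < 0 := by
  classical
  refine (hμ.hess_nonpos hclique hp hq hpq).lt_of_ne fun hhess => ?_
  have hmerge : 3 * (μ p + μ q) = 2 * (A + B) := by
    rw [hess_chordCoeff_of_isClique hclique hsum hp hq hpq] at hhess
    have : 3 * ((μ p : ℝ) + μ q) = 2 * (A + B) := by linarith
    exact_mod_cast this
  have hνsum := sum_setPair hpq (add_zero (μ p + μ q))
  have hνp : setPair μ p q (μ p + μ q) 0 p = μ p + μ q := setPair_left hpq ..
  have hνclique := hclique.subset (support_setPair_subset hp hq (μ p + μ q) 0)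
  have hν := hμ.setPair_of_hess_eq_zero hclique hp hq hpq hhess (add_zero _)
  generalize setPair μ p q (μ p + μ q) 0 = ν at *
  have hle (x : V) (hx : ν x ≠ 0) : A ≤ ν x := by
    rcases eq_or_ne p x with rfl | hpx
    · omega
    have hneg : hess (chordCoeff n A B) 1 G (fun x => ν x) p x < 0 := by
      have hmerge' : 3 * (ν p : ℝ) = 2 * (A + B) := by exact_mod_cast hνp ▸ hmerge
      have hx' : (0 : ℝ) < ν x := by exact_mod_cast Nat.pos_of_ne_zero hx
      rw [hess_chordCoeff_of_isClique hνclique (hνsum.trans hsum) (by omega) hx hpx]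
      linarith
    have := hν.le_add_one_of_hess_neg hνclique (by omega) hx hpx hneg
    omega
  have hpos : 0 < ∑ x, gapCubic A B (ν x) := by
    have hnonneg := gapCubic_nonneg_of_forall hBA (Or.inl hle)
    refine Finset.sum_pos' (fun x _ => hnonneg x) ⟨p, Finset.mem_univ p, (hnonneg p).lt_of_ne' ?_⟩
    rw [Ne, gapCubic_eq_zero]
    omega
  have hνzero : chordEnergy n A B G (fun x => ν x) = 0 := by
    rw [← hzero, chordEnergy, chordEnergy, hμ.energy_eq hν hνsum]
  rw [chordEnergy_of_isClique hνclique (hνsum.trans hsum)] at hνzero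
  linarith

lemma forall_eq_or_forall_eq_of_isClique (hA : r * A = n) (hB : (r + 1) * B = n) (hBA : B < A)
    (hAB : A < 2 * B) (hsum : ∑ x, μ x = n) (hzero : chordEnergy n A B G (fun x => μ x) = 0)
    (hclique : G.IsClique μ.support) :
    (∀ x, μ x ≠ 0 → μ x = A) ∨ ∀ x, μ x ≠ 0 → μ x = B := by
  have hμ := isMinWeight_of_chordEnergy_eq_zero hA hB hBA.le hsum hzero
  have hcases := forall_le_or_forall_le hA hB hsum (hμ.equitableOn hclique fun p q hp hq hpq =>
    (hess_neg_of_isMinWeight hBA.le hAB hμ hsum hzero hclique hp hq hpq).ne)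
  have hvalue (x : V) : μ x = 0 ∨ μ x = A ∨ μ x = B := by
    have hnonneg := gapCubic_nonneg_of_forall hBA.le hcases
    rw [chordEnergy_of_isClique hclique hsum, mul_eq_zero_iff_left two_ne_zero,
      Finset.sum_eq_zero_iff_of_nonneg fun x _ => hnonneg x] at hzero
    exact gapCubic_eq_zero.1 (hzero x (Finset.mem_univ x))
  refine hcases.imp (fun h x hx => ?_) fun h x hx => ?_ <;>
  · have := h x hx
    have := hvalue x
    omega

lemma not_adj_trans_of_chordEnergy_eq_zero {u v w : V} (hA : r * A = n) (hB : (r + 1) * B = n)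
    (hBA : B ≤ A) (hAB : A < 2 * B) (hsum : ∑ x, μ x = n)
    (hzero : chordEnergy n A B G (fun x => μ x) = 0) (hu : μ u ≠ 0) (hv : μ v ≠ 0) (hw : μ w ≠ 0)
    (huv : ¬ G.Adj u v) (hvw : ¬ G.Adj v w) : ¬ G.Adj u w := fun huw => by
  have hμ := isMinWeight_of_chordEnergy_eq_zero hA hB hBA hsum hzero
  have hhess := hμ.hess_eq_zero_of_not_adj hu hv hw (fun h => huv h.symm) hvw
  obtain ⟨ν, hνsum, hν, hνu, hνw, hcodeg, hclique⟩ := hμ.exists_isClique_codeg_le hu hw huw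
  have hνzero : chordEnergy n A B G (fun x => ν x) = 0 := by
    rw [← hzero, chordEnergy, chordEnergy, hμ.energy_eq hν hνsum]
  have hneg := hess_neg_of_isMinWeight hBA hAB hν (hνsum.trans hsum) hνzero hclique hνu hνw huw.ne
  rw [hess_of_adj huw] at hhess hneg
  linarith

lemma forall_fiberCard_eq_or_of_chordEnergy_comap_top {W : Type*} {c : V → W}
    (hc : c.Surjective) (hA : r * A = n) (hB : (r + 1) * B = n) (hBA : B < A) (hAB : A < 2 * B)
    (hn : Fintype.card V = n) (hzero : chordEnergy n A B ((⊤ : SimpleGraph W).comap c) 1 = 0) :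
    (∀ w, fiberCard c w = A) ∨ ∀ w, fiberCard c w = B := by
  have : Fintype W := @Fintype.ofFinite W (.of_surjective c hc)
  rw [chordEnergy, energy_comap] at hzero
  exact (forall_eq_or_forall_eq_of_isClique hA hB hBA hAB ((sum_fiberCard c).trans hn) hzero
    fun _ _ _ _ => id).imp (fun h w => h w (fiberCard_ne_zero.2 (hc w)))
    fun h w => h w (fiberCard_ne_zero.2 (hc w))

lemma isCompleteMultipartite_of_chordEnergy_eq_zero (hA : r * A = n) (hB : (r + 1) * B = n)
    (hBA : B ≤ A) (hAB : A < 2 * B) (hn : Fintype.card V = n) (hzero : chordEnergy n A B G 1 = 0) :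
    G.IsCompleteMultipartite := ⟨fun u v w => by
  have hone : ∑ _x : V, 1 = n := by simpa using hn
  refine not_adj_trans_of_chordEnergy_eq_zero hA hB hBA hAB hone ?_ one_ne_zero one_ne_zero
    one_ne_zero
  simp only [Nat.cast_one]
  exact hzero⟩

lemma eq_comap_top_mk {V : Type*} {G : SimpleGraph V} (hG : G.IsCompleteMultipartite) :
    G = (⊤ : SimpleGraph (Quotient hG.setoid)).comap (Quotient.mk hG.setoid) := by
  ext x y
  rw [SimpleGraph.comap_adj, SimpleGraph.top_adj, Ne, Quotient.eq]
  exact not_not.symm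

theorem exists_eq_comap_top_of_chordEnergy_eq_zero {V : Type u} [Fintype V] {G : SimpleGraph V}
    (hA : r * A = n) (hB : (r + 1) * B = n) (hBA : B < A) (hAB : A < 2 * B)
    (hn : Fintype.card V = n) (hzero : chordEnergy n A B G 1 = 0) :
    ∃ (W : Type u) (c : V → W), G = (⊤ : SimpleGraph W).comap c ∧
      ((∀ w, fiberCard c w = A) ∨ ∀ w, fiberCard c w = B) := by
  have hG := isCompleteMultipartite_of_chordEnergy_eq_zero hA hB hBA.le hAB hn hzero
  have hzero' : chordEnergy n A B
      ((⊤ : SimpleGraph (Quotient hG.setoid)).comap (Quotient.mk hG.setoid)) 1 = 0 :=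
    (congrArg (chordEnergy n A B · 1) (eq_comap_top_mk hG)).symm.trans hzero
  exact ⟨_, _, eq_comap_top_mk hG,
    forall_fiberCard_eq_or_of_chordEnergy_comap_top Quotient.mk_surjective hA hB hBA hAB hn hzero'⟩

lemma chordEnergy_eq_tGraph (hn : n ≠ 0) (A B : ℕ) (G : SimpleGraph (Fin n)) :
    chordEnergy n A B G 1 = chordCoeff n A B * n ^ 2 * tGraph G 0 + n ^ 3 * tGraph G 1 -
      (chordCoeff n A B * n ^ 2 + n ^ 3 - 2 * A * B * n) := by
  have hn' : (n : ℝ) ≠ 0 := Nat.cast_ne_zero.2 hn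
  rw [chordEnergy, energy, tGraph_eq]
  simp only [Matrix.cons_val_zero, Matrix.cons_val_one, Matrix.cons_val_fin_one]
  field_simp

lemma chordEnergy_eq_zero_of_mem_segment (hn : n ≠ 0) {G : SimpleGraph (Fin n)}
    (hG : tGraph G ∈ segment ℝ (turanPoint (A / n)) (turanPoint (B / n))) :
    chordEnergy n A B G 1 = 0 := by
  have hn' : (n : ℝ) ≠ 0 := Nat.cast_ne_zero.2 hn
  obtain ⟨s, t, -, -, hst, hG⟩ := hG
  rw [chordEnergy_eq_tGraph hn, ← hG, eq_sub_of_add_eq hst, chordCoeff]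
  simp only [turanPoint, PiLp.add_apply, PiLp.smul_apply, Matrix.cons_val_zero,
    Matrix.cons_val_one, Matrix.cons_val_fin_one, smul_eq_mul]
  field_simp
  ring

theorem segment_turanPoint_inter_S (hA : r * A = n) (hB : (r + 1) * B = n) (hn : n ≠ 0)
    (hr : 1 < r) :
    segment ℝ (turanPoint (A / n)) (turanPoint (B / n)) ∩ S n ⊆
      {turanPoint (A / n), turanPoint (B / n)} := by
  have hB0 : 0 < B := Nat.pos_of_ne_zero fun h => hn (by rw [← hB, h, mul_zero])
  have hBA : B < A := by
    by_contra! hle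
    nlinarith [Nat.mul_le_mul_left r hle]
  have hAB : A < 2 * B := by
    by_contra! hle
    nlinarith [Nat.mul_le_mul_left r hle]
  rintro _ ⟨hsegment, G, rfl⟩
  obtain ⟨W, c, hcomap, hc⟩ := exists_eq_comap_top_of_chordEnergy_eq_zero hA hB hBA hAB
    (Fintype.card_fin n) (chordEnergy_eq_zero_of_mem_segment hn hsegment)
  simp only [hcomap]
  exact hc.imp (tGraph_comap_top_of_fiberCard_eq hn) (tGraph_comap_top_of_fiberCard_eq hn)

theorem Ln_inter_S {k : ℕ} (hn : n ≠ 0) (h : (k + 1) * (k + 2) ∣ n) (hk : 1 ≤ k) :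
    Ln k n ∩ S n = {vn k n, vn (k + 1) n} := by
  refine subset_antisymm ?_ (Set.pair_subset ⟨left_mem_segment ℝ _ _, _, rfl⟩
    ⟨right_mem_segment ℝ _ _, _, rfl⟩)
  rw [Ln, vn_of_dvd hn (dvd_of_mul_right_dvd h), vn_of_dvd hn (dvd_of_mul_left_dvd h)]
  obtain ⟨m, rfl⟩ := h
  have hm : (m : ℝ) ≠ 0 := Nat.cast_ne_zero.2 (right_ne_zero_of_mul hn)
  have hA : 1 / ((k : ℝ) + 1) = ((k + 2) * m : ℕ) / ((k + 1) * (k + 2) * m : ℕ) := by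
    push_cast
    field_simp
  have hB : 1 / (((k + 1 : ℕ) : ℝ) + 1) = ((k + 1) * m : ℕ) / ((k + 1) * (k + 2) * m : ℕ) := by
    push_cast
    field_simp
    ring
  rw [hA, hB]
  exact segment_turanPoint_inter_S (r := k + 1) (by ring) (by ring) hn (by omega)

end Chord

/-! ### Step graphons -/

section StepGraphon

variable {m n : ℕ}

/-- The index of the part of `[0, 1]`, cut into `n` intervals of equal length, that contains `x`.
The endpoint `x = 1` wraps around to the part `0`. -/
def partIndex (n : ℕ) [NeZero n] (x : I) : Fin n :=
  Fin.ofNat n ⌊(x : ℝ) * n⌋₊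

lemma floor_mul_lt [NeZero n] {x : I} (hx : x ≠ 1) : ⌊(x : ℝ) * n⌋₊ < n := by
  have hn : (0 : ℝ) < n := Nat.cast_pos.2 (NeZero.pos n)
  rw [Nat.floor_lt (mul_nonneg x.2.1 hn.le)]
  exact mul_lt_of_lt_one_left hn (unitInterval.lt_one_iff_ne_one.2 hx)

lemma val_partIndex [NeZero n] {x : I} (hx : x ≠ 1) : (partIndex n x : ℕ) = ⌊(x : ℝ) * n⌋₊ :=
  Nat.mod_eq_of_lt (floor_mul_lt hx)

lemma partIndex_eq_partIndex [NeZero n] {x y : I} (hx : x ≠ 1) (hy : y ≠ 1) :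
    partIndex n x = partIndex n y ↔ ⌊(x : ℝ) * n⌋ = ⌊(y : ℝ) * n⌋ := by
  rw [Fin.ext_iff, val_partIndex hx, val_partIndex hy,
    ← Int.natCast_floor_eq_floor (mul_nonneg x.2.1 n.cast_nonneg),
    ← Int.natCast_floor_eq_floor (mul_nonneg y.2.1 n.cast_nonneg), Nat.cast_inj]

lemma measurable_partIndex (n : ℕ) [NeZero n] : Measurable (partIndex n) :=
  (Measurable.of_discrete (f := Fin.ofNat n)).comp
    (Nat.measurable_floor.comp (measurable_subtype_coe.mul_const _))

lemma volume_partIndex_preimage [NeZero n] (i : Fin n) :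
    volume (partIndex n ⁻¹' {i}) = ENNReal.ofReal (1 / n) := by
  have hn : (0 : ℝ) < n := Nat.cast_pos.2 (NeZero.pos n)
  have hi : (i : ℝ) + 1 ≤ n := by exact_mod_cast i.2
  let p : I := ⟨i / n, by positivity, (div_le_one hn).2 (by linarith)⟩
  let q : I := ⟨(i + 1) / n, by positivity, (div_le_one hn).2 hi⟩
  have hpart : partIndex n ⁻¹' {i} =ᵐ[volume] Set.Ico p q := by
    have hne : ∀ᵐ x : I, x ≠ 1 := compl_mem_ae_iff.2 (measure_singleton 1)
    filter_upwards [hne] with x hx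
    refine propext ?_
    change partIndex n x = i ↔ (i : ℝ) / n ≤ x ∧ (x : ℝ) < (i + 1) / n
    rw [Fin.ext_iff, val_partIndex hx, Nat.floor_eq_iff (mul_nonneg x.2.1 hn.le),
      div_le_iff₀ hn, lt_div_iff₀ hn]
  rw [measure_congr hpart, unitInterval.volume_Ico, ← sub_div, add_sub_cancel_left]

lemma integral_partIndex [NeZero n] (Φ : (Fin m → Fin n) → ℝ) :
    ∫ x : Fin m → I, Φ (fun i => partIndex n (x i)) = (∑ g, Φ g) / (n : ℝ) ^ m := by
  have : IsProbabilityMeasure ((volume : Measure I).map (partIndex n)) :=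
    Measure.isProbabilityMeasure_map (measurable_partIndex n).aemeasurable
  have hmap : (volume : Measure (Fin m → I)).map (fun x i => partIndex n (x i)) =
      Measure.pi fun _ => (volume : Measure I).map (partIndex n) :=
    Measure.pi_map_pi fun _ => (measurable_partIndex n).aemeasurable
  have hsingleton (i : Fin n) : (volume : Measure I).map (partIndex n) {i} =
      ENNReal.ofReal (1 / n) := by
    rw [Measure.map_apply (measurable_partIndex n) (measurableSet_singleton _),
      volume_partIndex_preimage]
  have hmeas : Measurable fun (x : Fin m → I) i => partIndex n (x i) :=
    measurable_pi_lambda _ fun i => (measurable_partIndex n).comp (measurable_pi_apply i)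
  rw [← integral_map (φ := fun (x : Fin m → I) i => partIndex n (x i)) (f := Φ)
    hmeas.aemeasurable Measurable.of_discrete.aestronglyMeasurable, hmap,
    integral_fintype Integrable.of_finite, Finset.sum_div]
  refine Finset.sum_congr rfl fun g _ => ?_
  rw [measureReal_def, Measure.pi_singleton, Finset.prod_congr rfl fun i _ => hsingleton (g i),
    Finset.prod_const, Finset.card_univ, Fintype.card_fin, ENNReal.toReal_pow,
    ENNReal.toReal_ofReal (by positivity), smul_eq_mul, one_div, inv_pow, div_eq_inv_mul]

/-- The graphon of a graph: the indicator of adjacency of the parts containing the arguments. -/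
def stepGraphon [NeZero n] (G : SimpleGraph (Fin n)) : Graphon where
  toFun x y := adj G (partIndex n x) (partIndex n y)
  measurable_toFun :=
    (Measurable.of_discrete (f := fun p : Fin n × Fin n => adj G p.1 p.2)).comp
      (((measurable_partIndex n).comp measurable_fst).prodMk
        ((measurable_partIndex n).comp measurable_snd))
  symm _ _ := adj_comm G _ _
  mem_Icc _ _ := ⟨adj_nonneg G _ _, Set.indicator_le_self' (fun _ _ => zero_le_one) _⟩

lemma homDensity_stepGraphon [NeZero n] (G : SimpleGraph (Fin n)) (H : SimpleGraph (Fin m))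
    [DecidableRel H.Adj] : (stepGraphon G).homDensity H = homDensity H G := by
  rw [homDensity, card_hom_eq_sum_prod_indicator, ← integral_partIndex, Graphon.homDensity]
  refine integral_congr_ae (Eventually.of_forall fun x => Finset.prod_congr rfl fun e _ => ?_)
  induction e
  rfl

lemma tGraphon_stepGraphon [NeZero n] (G : SimpleGraph (Fin n)) :
    tGraphon (stepGraphon G) = tGraph G := by
  rw [tGraphon, tGraph, homDensity_stepGraphon, homDensity_stepGraphon]

lemma Pn_subset_P (hn : n ≠ 0) : Pn n ⊆ P := by
  have : NeZero n := ⟨hn⟩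
  refine convexHull_mono ?_
  rintro _ ⟨G, rfl⟩
  exact ⟨stepGraphon G, tGraphon_stepGraphon G⟩

lemma homDensity_congr {f g : Graphon}
    (h : ∀ x y : I, x ≠ 1 → y ≠ 1 → f.toFun x y = g.toFun x y) (H : SimpleGraph (Fin m))
    [DecidableRel H.Adj] : f.homDensity H = g.homDensity H := by
  have hne : ∀ᵐ x : Fin m → I, ∀ i, x i ≠ 1 :=
    eventually_all.2 fun i => Measure.ae_eval_ne (fun _ : Fin m => (volume : Measure I)) i 1
  refine integral_congr_ae ?_
  filter_upwards [hne] with x hx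
  refine Finset.prod_congr rfl fun e _ => ?_
  induction e with
  | h i j => exact h _ _ (hx i) (hx j)

lemma turanGraphon_toFun {r : ℕ} [NeZero r] {x y : I} (hx : x ≠ 1) (hy : y ≠ 1) :
    (turanGraphon r).toFun x y = if partIndex r x = partIndex r y then 0 else 1 := by
  rw [turanGraphon]
  split_ifs with hr hxy hxy
  · rfl
  · subst hr
    exact absurd (Subsingleton.elim _ _) hxy
  · exact if_pos ((partIndex_eq_partIndex hx hy).1 hxy)
  · exact if_neg (mt (partIndex_eq_partIndex hx hy).2 hxy)

lemma v_eq_vn (k : ℕ) : v k = vn k (k + 1) := by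
  have hturan (x y : I) (hx : x ≠ 1) (hy : y ≠ 1) : (turanGraphon (k + 1)).toFun x y =
      (stepGraphon (⊤ : SimpleGraph (Fin (k + 1)))).toFun x y := by
    rw [turanGraphon_toFun hx hy]
    split_ifs with h
    · exact (adj_of_not_adj (not_not.2 h)).symm
    · exact (adj_of_adj h).symm
  rw [v, vn, SimpleGraph.turanGraph_eq_top.2 (Or.inr le_rfl), ← tGraphon_stepGraphon, tGraphon,
    tGraphon, homDensity_congr hturan, homDensity_congr hturan]

lemma v_eq_turanPoint (k : ℕ) : v k = turanPoint (1 / (k + 1)) := by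
  rw [v_eq_vn, vn_of_dvd k.succ_ne_zero dvd_rfl]

end StepGraphon

/-! ### Sampling -/

section Sampling

/-- The probability that a random set containing each `e` independently with probability `w e`
equals `B`. -/
def bernoulliWeight {ι : Type*} [Fintype ι] [DecidableEq ι] (w : ι → ℝ) (B : Finset ι) : ℝ :=
  (∏ e ∈ B, w e) * ∏ e ∈ Bᶜ, (1 - w e)

lemma bernoulliWeight_nonneg {ι : Type*} [Fintype ι] [DecidableEq ι] {w : ι → ℝ}
    (hw : ∀ e, w e ∈ Set.Icc (0 : ℝ) 1) (B : Finset ι) : 0 ≤ bernoulliWeight w B :=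
  mul_nonneg (Finset.prod_nonneg fun e _ => (hw e).1)
    (Finset.prod_nonneg fun e _ => sub_nonneg.2 (hw e).2)

lemma sum_bernoulliWeight_of_subset {ι : Type*} [Fintype ι] [DecidableEq ι] (w : ι → ℝ)
    (A : Finset ι) : ∑ B with A ⊆ B, bernoulliWeight w B = ∏ e ∈ A, w e := by
  have hprod : ∏ e, (w e + if e ∈ A then 0 else 1 - w e) = ∏ e ∈ A, w e := by
    rw [← Fintype.prod_ite_mem A w]
    refine Finset.prod_congr rfl fun e _ => ?_
    split_ifs <;> ring
  rw [← hprod, Fintype.prod_add, Finset.sum_filter]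
  refine Finset.sum_congr rfl fun B _ => ?_
  split_ifs with hAB
  · refine congrArg _ (Finset.prod_congr rfl fun e he => (if_neg fun heA => ?_).symm)
    exact Finset.mem_compl.1 he (hAB heA)
  · obtain ⟨e, heA, heB⟩ := Finset.not_subset.1 hAB
    have hzero : ∏ e ∈ Bᶜ, (if e ∈ A then 0 else 1 - w e) = 0 :=
      Finset.prod_eq_zero (Finset.mem_compl.2 heB) (if_pos heA)
    rw [hzero, mul_zero]

variable {m n : ℕ}

lemma Graphon.pairValue_map (f : Graphon) (x : Fin n → I) (g : Fin m → Fin n) (e : Sym2 (Fin m)) :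
    f.pairValue x (e.map g) = f.pairValue (fun i => x (g i)) e := by
  induction e
  rfl

lemma Graphon.pairValue_mem (f : Graphon) (x : Fin n → I) (e : Sym2 (Fin n)) :
    f.pairValue x e ∈ Set.Icc (0 : ℝ) 1 := by
  induction e
  exact f.mem_Icc _ _

lemma Graphon.measurable_pairValue (f : Graphon) (e : Sym2 (Fin n)) :
    Measurable fun x : Fin n → I => f.pairValue x e := by
  induction e with
  | h i j =>
    have hpair : Measurable fun x : Fin n → I => (x i, x j) :=
      (measurable_pi_apply i).prodMk (measurable_pi_apply j)
    exact f.measurable_toFun.comp hpair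

/-- The product of the values of a graphon over all pairs of sample points, whose integral is the
homomorphism density of a clique. -/
def cliqueValue (f : Graphon) (x : Fin m → I) : ℝ :=
  ∏ e ∈ (⊤ : SimpleGraph (Fin m)).edgeFinset, f.pairValue x e

lemma cliqueValue_mem (f : Graphon) (x : Fin m → I) : cliqueValue f x ∈ Set.Icc (0 : ℝ) 1 :=
  ⟨Finset.prod_nonneg fun e _ => (f.pairValue_mem x e).1,
    Finset.prod_le_one (fun e _ => (f.pairValue_mem x e).1) fun e _ => (f.pairValue_mem x e).2⟩

lemma measurable_cliqueValue (m : ℕ) (f : Graphon) :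
    Measurable fun x : Fin m → I => cliqueValue f x :=
  Finset.measurable_prod _ fun e _ => f.measurable_pairValue e

lemma integrable_cliqueValue (m : ℕ) (f : Graphon) :
    Integrable fun x : Fin m → I => cliqueValue f x :=
  Integrable.of_bound (measurable_cliqueValue m f).aestronglyMeasurable 1 <|
    Eventually.of_forall fun x => by
      rw [Real.norm_eq_abs, abs_of_nonneg (cliqueValue_mem f x).1]
      exact (cliqueValue_mem f x).2

lemma Graphon.homDensity_top_mem (f : Graphon) (m : ℕ) :
    f.homDensity (⊤ : SimpleGraph (Fin m)) ∈ Set.Icc (0 : ℝ) 1 :=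
  (convex_Icc 0 1).integral_mem isClosed_Icc (Eventually.of_forall (cliqueValue_mem f))
    (integrable_cliqueValue m f)

lemma measurePreserving_comp_embedding {ι κ Ω : Type*} [Fintype ι] [Fintype κ] [MeasurableSpace Ω]
    (μ : Measure Ω) [IsProbabilityMeasure μ] (g : ι ↪ κ) :
    MeasurePreserving (fun (x : κ → Ω) i => x (g i)) (Measure.pi fun _ => μ)
      (Measure.pi fun _ => μ) := by
  have hindep := (ProbabilityTheory.iIndepFun_pi (μ := fun _ : κ => μ) (X := fun _ => id)
    fun _ => aemeasurable_id).precomp g.injective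
  refine ⟨measurable_pi_lambda _ fun i => measurable_pi_apply _, ?_⟩
  refine (hindep.map_fun_eq_pi_map fun i => (measurable_pi_apply _).aemeasurable).trans ?_
  exact congrArg Measure.pi (funext fun i => (measurePreserving_eval (fun _ : κ => μ) (g i)).map_eq)

/-- The density of injective homomorphisms of the clique on `m` vertices into the weighted graph on
`n` sample points of a graphon. -/
def sampleDensity (m : ℕ) (f : Graphon) (x : Fin n → I) : ℝ :=
  (∑ g : Fin m ↪ Fin n, cliqueValue f fun i => x (g i)) / (n : ℝ) ^ m

lemma integrable_cliqueValue_comp (f : Graphon) (g : Fin m ↪ Fin n) :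
    Integrable fun x : Fin n → I => cliqueValue f fun i => x (g i) :=
  (measurePreserving_comp_embedding volume g).integrable_comp_of_integrable
    (integrable_cliqueValue m f)

lemma integrable_sampleDensity (m : ℕ) (f : Graphon) :
    Integrable fun x : Fin n → I => sampleDensity m f x :=
  (integrable_finsetSum _ fun g _ => integrable_cliqueValue_comp f g).div_const _

lemma integral_sampleDensity (m : ℕ) (f : Graphon) :
    ∫ x : Fin n → I, sampleDensity m f x =
      (n.descFactorial m : ℝ) / (n : ℝ) ^ m * f.homDensity (⊤ : SimpleGraph (Fin m)) := by
  have hterm (g : Fin m ↪ Fin n) : ∫ x : Fin n → I, cliqueValue f (fun i => x (g i)) =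
      f.homDensity (⊤ : SimpleGraph (Fin m)) := by
    have hg : MeasurePreserving (fun (x : Fin n → I) i => x (g i)) volume volume :=
      measurePreserving_comp_embedding volume g
    rw [← integral_map (f := cliqueValue f) hg.measurable.aemeasurable
      (measurable_cliqueValue m f).aestronglyMeasurable, hg.map_eq]
    rfl
  simp only [sampleDensity]
  rw [integral_div, integral_finsetSum _ fun g _ => integrable_cliqueValue_comp f g,
    Finset.sum_congr rfl fun g _ => hterm g, Finset.sum_const, Finset.card_univ,
    Fintype.card_embedding_eq, Fintype.card_fin, Fintype.card_fin, nsmul_eq_mul, mul_div_right_comm]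

lemma prod_indicator_fromEdgeSet (B : Finset (Sym2 (Fin n))) (g : Fin m ↪ Fin n) :
    ∏ e ∈ (⊤ : SimpleGraph (Fin m)).edgeFinset,
        (SimpleGraph.fromEdgeSet (B : Set (Sym2 (Fin n)))).edgeSet.indicator
          (1 : Sym2 (Fin n) → ℝ) (e.map g) =
      if (⊤ : SimpleGraph (Fin m)).edgeFinset.image (Sym2.map g) ⊆ B then 1 else 0 := by
  have hmem {e : Sym2 (Fin m)} (he : e ∈ (⊤ : SimpleGraph (Fin m)).edgeFinset) :
      e.map g ∈ (SimpleGraph.fromEdgeSet (B : Set (Sym2 (Fin n)))).edgeSet ↔ e.map g ∈ B := by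
    induction e with
    | h i j =>
      have hij : i ≠ j := by simpa using he
      simp [hij]
  classical
  simp only [Set.indicator_apply, Pi.one_apply, Finset.prod_boole]
  congr 1
  rw [Finset.image_subset_iff]
  exact propext (forall₂_congr fun e he => hmem he)

lemma prod_indicator_of_not_injective (G : SimpleGraph (Fin n)) {g : Fin m → Fin n}
    (hg : ¬ g.Injective) :
    ∏ e ∈ (⊤ : SimpleGraph (Fin m)).edgeFinset,
      G.edgeSet.indicator (1 : Sym2 (Fin n) → ℝ) (e.map g) = 0 := by
  obtain ⟨i, j, hij, hne⟩ := Function.not_injective_iff.1 hg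
  refine Finset.prod_eq_zero (i := s(i, j)) (by simpa using hne) ?_
  rw [Sym2.map_mk, hij]
  exact adj_self G (g j)

lemma homDensity_top_eq_sum_embedding (m : ℕ) (G : SimpleGraph (Fin n)) :
    homDensity (⊤ : SimpleGraph (Fin m)) G =
      (∑ g : Fin m ↪ Fin n, ∏ e ∈ (⊤ : SimpleGraph (Fin m)).edgeFinset,
        G.edgeSet.indicator 1 (e.map g)) / (n : ℝ) ^ m := by
  rw [homDensity, card_hom_eq_sum_prod_indicator]
  refine congrArg (· / (n : ℝ) ^ m) (Fintype.sum_of_injective _ DFunLike.coe_injective _ _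
    (fun g hg => ?_) fun g => rfl).symm
  exact prod_indicator_of_not_injective G fun hinj => hg ⟨⟨g, hinj⟩, rfl⟩

lemma sampleDensity_eq_sum (m : ℕ) (f : Graphon) (x : Fin n → I) :
    sampleDensity m f x = ∑ B, bernoulliWeight (f.pairValue x) B *
      homDensity (⊤ : SimpleGraph (Fin m))
        (SimpleGraph.fromEdgeSet (B : Set (Sym2 (Fin n)))) := by
  have hclique (g : Fin m ↪ Fin n) : cliqueValue f (fun i => x (g i)) =
      ∑ B with (⊤ : SimpleGraph (Fin m)).edgeFinset.image (Sym2.map g) ⊆ B,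
        bernoulliWeight (f.pairValue x) B := by
    rw [sum_bernoulliWeight_of_subset, Finset.prod_image (Sym2.map.injective g.injective).injOn]
    exact Finset.prod_congr rfl fun e _ => (f.pairValue_map x g e).symm
  simp only [homDensity_top_eq_sum_embedding, prod_indicator_fromEdgeSet, ← mul_div_assoc,
    Finset.mul_sum, mul_ite, mul_one, mul_zero]
  rw [← Finset.sum_div, Finset.sum_comm, sampleDensity]
  simp only [hclique, Finset.sum_filter]

lemma sampleDensity_mem_Pn (f : Graphon) (x : Fin n → I) :
    !₂[sampleDensity 2 f x, sampleDensity 3 f x] ∈ Pn n := by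
  have hmixture : !₂[sampleDensity 2 f x, sampleDensity 3 f x] =
      ∑ B, bernoulliWeight (f.pairValue x) B •
        tGraph (SimpleGraph.fromEdgeSet (B : Set (Sym2 (Fin n)))) := by
    ext i
    fin_cases i <;> simp [sampleDensity_eq_sum, tGraph]
  rw [hmixture]
  refine (convex_convexHull ℝ _).sum_mem
    (fun B _ => bernoulliWeight_nonneg (f.pairValue_mem x) B) ?_ fun B _ =>
      subset_convexHull ℝ _ ⟨_, rfl⟩
  simpa using sum_bernoulliWeight_of_subset (f.pairValue x) ∅

lemma isClosed_Pn (n : ℕ) : IsClosed (Pn n) :=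
  ((Set.finite_range _).isCompact_convexHull ℝ).isClosed

theorem integral_sampleDensity_mem_Pn (f : Graphon) (n : ℕ) :
    !₂[∫ x : Fin n → I, sampleDensity 2 f x, ∫ x : Fin n → I, sampleDensity 3 f x] ∈ Pn n := by
  have hint (i : Fin 2) : Integrable fun x : Fin n → I =>
      (!₂[sampleDensity 2 f x, sampleDensity 3 f x] : EuclideanSpace ℝ (Fin 2)) i := by
    fin_cases i
    · exact integrable_sampleDensity 2 f
    · exact integrable_sampleDensity 3 f
  have hcoord : !₂[∫ x : Fin n → I, sampleDensity 2 f x, ∫ x : Fin n → I, sampleDensity 3 f x] =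
      ∫ x : Fin n → I, !₂[sampleDensity 2 f x, sampleDensity 3 f x] := by
    ext i
    rw [eval_integral_piLp hint]
    fin_cases i <;> rfl
  rw [hcoord]
  exact (convex_convexHull ℝ _).integral_mem (isClosed_Pn n)
    (Eventually.of_forall (sampleDensity_mem_Pn f)) (Integrable.of_eval_piLp hint)

end Sampling

/-! ### Convergence of the polytopes -/

section Limit

variable {n : ℕ}

lemma convexHull_eq_iUnion_image_stdSimplex {E : Type*} [AddCommGroup E] [Module ℝ E]
    [FiniteDimensional ℝ E] (K : Set E) :
    convexHull ℝ K = ⋃ c ∈ Finset.range (Module.finrank ℝ E + 2),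
      (fun p : (Fin c → ℝ) × (Fin c → E) => ∑ i, p.1 i • p.2 i) ''
        (stdSimplex ℝ (Fin c) ×ˢ Set.univ.pi fun _ => K) := by
  refine subset_antisymm (fun x hx => ?_) ?_
  · obtain ⟨ι, _, z, w, hz, hind, hw, hw1, hx⟩ := eq_pos_convex_span_of_mem_convexHull hx
    have hcard : Fintype.card ι < Module.finrank ℝ E + 2 :=
      Nat.lt_succ_of_le (hind.card_le_finrank_succ.trans
        (Nat.succ_le_succ (Submodule.finrank_le _)))
    let e := Fintype.equivFin ι
    refine Set.mem_biUnion (Finset.mem_coe.2 (Finset.mem_range.2 hcard))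
      ⟨(w ∘ e.symm, z ∘ e.symm), ⟨⟨fun i => (hw _).le, ?_⟩, fun i _ => hz ⟨_, rfl⟩⟩, ?_⟩
    · rw [← hw1]
      exact e.symm.sum_comp w
    · rw [← hx]
      exact e.symm.sum_comp fun i => w i • z i
  · simp only [Set.iUnion_subset_iff]
    rintro c - _ ⟨⟨w, z⟩, ⟨hw, hz⟩, rfl⟩
    exact (convex_convexHull ℝ K).sum_mem (fun i _ => hw.1 i) hw.2
      fun i _ => subset_convexHull ℝ K (hz i trivial)

lemma isCompact_convexHull_of_isCompact {E : Type*} [NormedAddCommGroup E] [NormedSpace ℝ E]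
    [FiniteDimensional ℝ E] {K : Set E} (hK : IsCompact K) : IsCompact (convexHull ℝ K) := by
  rw [convexHull_eq_iUnion_image_stdSimplex]
  exact Finset.isCompact_biUnion _ fun c _ =>
    ((isCompact_stdSimplex ℝ (Fin c)).prod (isCompact_univ_pi fun _ => hK)).image (by fun_prop)

lemma dist_euclidean_two_le (a b c d : ℝ) :
    dist (!₂[a, b] : EuclideanSpace ℝ (Fin 2)) !₂[c, d] ≤ |a - c| + |b - d| := by
  rw [EuclideanSpace.dist_eq, Fin.sum_univ_two]
  refine Real.sqrt_le_iff.2 ⟨by positivity, ?_⟩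
  change |a - c| ^ 2 + |b - d| ^ 2 ≤ _
  nlinarith [mul_nonneg (abs_nonneg (a - c)) (abs_nonneg (b - d))]

lemma one_sub_descFactorial_div_pow_le (hn : n ≠ 0) (m : ℕ) :
    1 - (n.descFactorial m : ℝ) / (n : ℝ) ^ m ≤ m.choose 2 / n := by
  have hn0 : (0 : ℝ) < n := by exact_mod_cast Nat.pos_of_ne_zero hn
  induction m with
  | zero => simp
  | succ m ih =>
    set d : ℝ := (n.descFactorial m : ℝ) / (n : ℝ) ^ m
    have hd0 : 0 ≤ d := by positivity
    have hd1 : d ≤ 1 :=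
      div_le_one_of_le₀ (by exact_mod_cast n.descFactorial_le_pow m) (by positivity)
    have hfactor : 1 - (m : ℝ) / n ≤ ((n - m : ℕ) : ℝ) / n := by
      rw [one_sub_div hn0.ne']
      gcongr
      rw [sub_le_iff_le_add]
      exact_mod_cast le_tsub_add
    have hsucc : (n.descFactorial (m + 1) : ℝ) / (n : ℝ) ^ (m + 1) = ((n - m : ℕ) : ℝ) / n * d := by
      rw [Nat.descFactorial_succ, Nat.cast_mul, pow_succ', mul_div_mul_comm]
    calc 1 - (n.descFactorial (m + 1) : ℝ) / (n : ℝ) ^ (m + 1)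
        = 1 - ((n - m : ℕ) : ℝ) / n * d := by rw [hsucc]
      _ ≤ 1 - (1 - (m : ℝ) / n) * d :=
          sub_le_sub_left (mul_le_mul_of_nonneg_right hfactor hd0) 1
      _ = m / n * d + (1 - d) := by ring
      _ ≤ m / n + m.choose 2 / n := add_le_add (mul_le_of_le_one_right (by positivity) hd1) ih
      _ = (m + 1).choose 2 / n := by
        rw [Nat.choose_succ_succ', Nat.choose_one_right, Nat.cast_add, add_div]

lemma abs_sub_descFactorial_div_pow_mul_le (hn : n ≠ 0) (m : ℕ) {s : ℝ}
    (hs : s ∈ Set.Icc (0 : ℝ) 1) :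
    |s - (n.descFactorial m : ℝ) / (n : ℝ) ^ m * s| ≤ m.choose 2 / n := by
  have hle : (n.descFactorial m : ℝ) / (n : ℝ) ^ m ≤ 1 :=
    div_le_one_of_le₀ (by exact_mod_cast n.descFactorial_le_pow m) (by positivity)
  rw [← one_sub_mul, abs_of_nonneg (mul_nonneg (sub_nonneg.2 hle) hs.1)]
  exact (mul_le_of_le_one_right (sub_nonneg.2 hle) hs.2).trans
    (one_sub_descFactorial_div_pow_le hn m)

lemma exists_dist_tGraphon_le (f : Graphon) (hn : n ≠ 0) :
    ∃ y ∈ Pn n, dist (tGraphon f) y ≤ 4 / n := by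
  refine ⟨_, integral_sampleDensity_mem_Pn f n, (dist_euclidean_two_le _ _ _ _).trans ?_⟩
  rw [integral_sampleDensity, integral_sampleDensity]
  refine (add_le_add (abs_sub_descFactorial_div_pow_mul_le hn 2 (f.homDensity_top_mem 2))
    (abs_sub_descFactorial_div_pow_mul_le hn 3 (f.homDensity_top_mem 3))).trans_eq ?_
  rw [← add_div]
  norm_num [Nat.choose]

lemma P_subset_cthickening (hn : n ≠ 0) : P ⊆ Metric.cthickening (4 / n) (Pn n) := by
  refine convexHull_min ?_ ((convex_convexHull ℝ _).cthickening _)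
  rintro _ ⟨f, rfl⟩
  obtain ⟨y, hy, hdist⟩ := exists_dist_tGraphon_le f hn
  exact Metric.mem_cthickening_of_dist_le _ y _ _ hy hdist

lemma tendsto_ofReal_const_div (c : ℝ) :
    Tendsto (fun n : ℕ => ENNReal.ofReal (c / n)) atTop (𝓝 0) := by
  simpa only [ENNReal.ofReal_zero] using
    ENNReal.tendsto_ofReal (tendsto_const_div_atTop_nhds_zero_nat c)

theorem tendsto_hausdorffEDist_Pn :
    Tendsto (fun n : ℕ => Metric.hausdorffEDist (Pn n) P) atTop (𝓝 0) := by
  refine tendsto_of_tendsto_of_tendsto_of_le_of_le' tendsto_const_nhds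
    (tendsto_ofReal_const_div 4) (Eventually.of_forall fun _ => zero_le) ?_
  filter_upwards [eventually_ne_atTop 0] with n hn
  refine Metric.hausdorffEDist_le_of_infEDist (fun x hx => ?_) fun x hx => ?_
  · rw [Metric.infEDist_zero_of_mem (Pn_subset_P hn hx)]
    exact zero_le
  · exact Metric.mem_cthickening_iff.1 (P_subset_cthickening hn hx)

lemma abs_classCard_div_sub_le (hn : n ≠ 0) (r : ℕ) [NeZero r] (i : Fin r) :
    |(classCard n r i : ℝ) / n - 1 / r| ≤ 1 / n := by
  have hn0 : (0 : ℝ) < n := by exact_mod_cast Nat.pos_of_ne_zero hn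
  have hr : 0 < r := NeZero.pos r
  have hr0 : (0 : ℝ) < r := by exact_mod_cast hr
  have hlower : ((n / r : ℕ) : ℝ) ≤ n / r := Nat.cast_div_le
  have hupper : (n : ℝ) / r < (n / r : ℕ) + 1 := by
    rw [div_lt_iff₀' hr0]
    exact_mod_cast Nat.lt_mul_div_succ n hr
  have hratio : (classCard n r i : ℝ) / n - 1 / r = ((classCard n r i : ℝ) - n / r) / n := by
    field_simp
  rw [hratio, abs_div, abs_of_pos hn0]
  refine div_le_div_of_nonneg_right ?_ hn0.le
  rw [classCard_eq, abs_le]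
  split_ifs <;> push_cast <;> constructor <;> linarith

lemma dist_turanPoint_le {x y : ℝ} (hx : x ∈ Set.Icc (0 : ℝ) 1) (hy : y ∈ Set.Icc (0 : ℝ) 1) :
    dist (turanPoint x) (turanPoint y) ≤ 4 * |x - y| := by
  have hfst : 1 - x - (1 - y) = y - x := by ring
  have hsnd : (1 - x) * (1 - 2 * x) - (1 - y) * (1 - 2 * y) = (x - y) * (2 * (x + y) - 3) := by ring
  have hfactor : |2 * (x + y) - 3| ≤ 3 := by
    rw [abs_le]
    constructor <;> linarith [hx.1, hx.2, hy.1, hy.2]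
  refine (dist_euclidean_two_le _ _ _ _).trans ?_
  rw [hfst, hsnd, abs_sub_comm y x, abs_mul]
  linarith [mul_le_mul_of_nonneg_left hfactor (abs_nonneg (x - y))]

lemma dist_vn_v_le (hn : n ≠ 0) (k : ℕ) : dist (vn k n) (v k) ≤ 4 / n := by
  have hn0 : (n : ℝ) ≠ 0 := by exact_mod_cast hn
  have hsum : ∑ i : Fin (k + 1), (classCard n (k + 1) i : ℝ) / n = 1 := by
    rw [← Finset.sum_div, div_eq_one_iff_eq hn0]
    exact_mod_cast sum_classCard n (k + 1)
  have hle (i : Fin (k + 1)) : (classCard n (k + 1) i : ℝ) / n ≤ 1 :=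
    hsum ▸ Finset.single_le_sum (f := fun i => (classCard n (k + 1) i : ℝ) / n)
      (fun j _ => by positivity) (Finset.mem_univ i)
  rw [vn_eq_sum hn, ← Metric.mem_closedBall]
  refine (convex_closedBall (v k) (4 / n)).sum_mem (fun i _ => by positivity) hsum fun i _ => ?_
  rw [Metric.mem_closedBall, v_eq_turanPoint]
  have hclose := abs_classCard_div_sub_le hn (k + 1) i
  push_cast at hclose
  refine (dist_turanPoint_le ⟨by positivity, hle i⟩ ⟨by positivity, ?_⟩).trans ?_
  · exact div_le_one_of_le₀ (by simp) (by positivity)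
  · linarith [mul_div_assoc (4 : ℝ) 1 n, mul_one (4 : ℝ)]

/-- The graphon that is identically one, the limit of the Turán graphons. -/
def oneGraphon : Graphon where
  toFun _ _ := 1
  measurable_toFun := measurable_const
  symm _ _ := rfl
  mem_Icc _ _ := ⟨zero_le_one, le_rfl⟩

lemma tGraphon_oneGraphon : tGraphon oneGraphon = turanPoint 0 := by
  have hpair {m : ℕ} (x : Fin m → I) (e : Sym2 (Fin m)) : oneGraphon.pairValue x e = 1 := by
    induction e
    rfl
  simp [tGraphon, Graphon.homDensity, hpair, turanPoint]

/-- The convex hull of the density vectors of the Turán graphons and of their limit, the constant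
graphon one. -/
def turanHull : Set (EuclideanSpace ℝ (Fin 2)) := convexHull ℝ (insert (turanPoint 0) (Set.range v))

lemma continuous_turanPoint : Continuous turanPoint := by
  refine (PiLp.continuous_toLp 2 _).comp (continuous_pi fun i => ?_)
  fin_cases i
  · exact continuous_const.sub continuous_id
  · exact (by fun_prop : Continuous fun x : ℝ => (1 - x) * (1 - 2 * x))

lemma isCompact_turanHull : IsCompact turanHull := by
  refine isCompact_convexHull_of_isCompact (Tendsto.isCompact_insert_range ?_)
  rw [funext v_eq_turanPoint]
  exact (continuous_turanPoint.tendsto 0).comp tendsto_one_div_add_atTop_nhds_zero_nat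

lemma Pn_subset_cthickening_turanHull (hn : n ≠ 0) :
    Pn n ⊆ Metric.cthickening (4 / n) turanHull := by
  have hvn (k : ℕ) : vn k n ∈ Metric.cthickening (4 / n) turanHull :=
    Metric.mem_cthickening_of_dist_le _ (v k) _ _
      (subset_convexHull ℝ _ (Or.inr ⟨k, rfl⟩)) (dist_vn_v_le hn k)
  rw [Pn_eq_convexHull_vertexSet hn]
  refine convexHull_min ?_ ((convex_convexHull ℝ _).cthickening _)
  rintro x (⟨k, -, rfl⟩ | rfl)
  · exact hvn k
  · exact hvn _

lemma P_subset_cthickening_turanHull (hn : n ≠ 0) :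
    P ⊆ Metric.cthickening (4 / n + 4 / n) turanHull :=
  (P_subset_cthickening hn).trans <|
    (Metric.cthickening_subset_of_subset _ (Pn_subset_cthickening_turanHull hn)).trans <|
      Metric.cthickening_cthickening_subset (by positivity) (by positivity) _

theorem P_eq_turanHull : P = turanHull := by
  refine subset_antisymm (fun x hx => ?_) (convexHull_mono ?_)
  · rw [← isCompact_turanHull.isClosed.closure_eq, Metric.mem_closure_iff_infEDist_zero]
    refine le_antisymm (ge_of_tendsto (tendsto_ofReal_const_div (4 + 4)) ?_) zero_le
    filter_upwards [eventually_ne_atTop 0] with n hn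
    rw [add_div]
    exact Metric.mem_cthickening_iff.1 (P_subset_cthickening_turanHull hn hx)
  · rintro x (rfl | ⟨k, rfl⟩)
    · exact ⟨oneGraphon, tGraphon_oneGraphon⟩
    · exact ⟨_, rfl⟩

theorem isCompact_P : IsCompact P := P_eq_turanHull ▸ isCompact_turanHull

end Limit

end EdgeTriangle

end

theorem mainTheorem4 :
    (∀ n : ℕ, 1 ≤ n →
      EdgeTriangle.Pn n =
        convexHull ℝ ({x | ∃ k : ℕ, k < ⌈(n : ℝ) / 2⌉₊ ∧ x = EdgeTriangle.vn k n} ∪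
          {EdgeTriangle.vn (n - 1) n})) ∧
    (IsCompact EdgeTriangle.P ∧
      Filter.Tendsto (fun n : ℕ => Metric.hausdorffEDist (EdgeTriangle.Pn n) EdgeTriangle.P)
        Filter.atTop (nhds 0)) ∧
    (∀ k n : ℕ, 1 ≤ n → (k + 1) * (k + 2) ∣ n →
      EdgeTriangle.vn k n = EdgeTriangle.v k ∧
      EdgeTriangle.vn (k + 1) n = EdgeTriangle.v (k + 1) ∧
      (1 ≤ k →
        EdgeTriangle.Ln k n ∩ EdgeTriangle.S n =
          {EdgeTriangle.v k, EdgeTriangle.v (k + 1)})) := by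
  refine ⟨fun n hn => EdgeTriangle.Pn_eq_convexHull_vertexSet (Nat.one_le_iff_ne_zero.1 hn),
    ⟨EdgeTriangle.isCompact_P, EdgeTriangle.tendsto_hausdorffEDist_Pn⟩, fun k n hn h => ?_⟩
  rw [Nat.one_le_iff_ne_zero] at hn
  have hleft : EdgeTriangle.vn k n = EdgeTriangle.v k := by
    rw [EdgeTriangle.v_eq_turanPoint, EdgeTriangle.vn_of_dvd hn (dvd_of_mul_right_dvd h)]
  have hright : EdgeTriangle.vn (k + 1) n = EdgeTriangle.v (k + 1) := by
    rw [EdgeTriangle.v_eq_turanPoint, EdgeTriangle.vn_of_dvd hn (dvd_of_mul_left_dvd h)]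
  exact ⟨hleft, hright, fun hk => hleft ▸ hright ▸ EdgeTriangle.Ln_inter_S hn h hk⟩
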